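/- Let $\Omega\subset\mathbb{R}^3$ be a bounded smooth domain (in particular connected), and let $\Gamma\in H^1(\Omega,\mathbb{R}^3)$ be a harmonic Neumann field. This means that $\Gamma$ is weakly curl-free, $\int_\Omega \Gamma\cdot\operatorname{curl}\psi\,dx=0$ for all $\psi\in C_c^\infty(\Omega,\mathbb{R}^3)$, and that $\Gamma$ is div-free and tangent to $\partial\Omega$ in the weak sense, $\int_\Omega \Gamma\cdot\nabla f\,dx=0$ for all $f\in H^1(\Omega)$. If there is a constant $c\in[0,\infty)$, the same on all connected components of $\partial\Omega$, such that the boundary trace $\Gamma|_{\partial\Omega}\in L^2(\partial\Omega,\mathbb{R}^3)$ satisfies $|\Gamma|_{\partial\Omega}|^2=c$ almost everywhere on $\partial\Omega$ with respect to surface measure, then $\Gamma=0$ almost everywhere in $\Omega$ (that is, $\Gamma=0$ as an element of $H^1(\Omega,\mathbb{R}^3)$). -/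

import Mathlib

open MeasureTheory Filter Topology
open scoped ContDiff

/-- Euclidean three-space. -/
abbrev E3 : Type := EuclideanSpace ℝ (Fin 3)

namespace HarmonicNeumann

/-- The classical partial derivative `∂ᵢ f` at `x`. -/
noncomputable def partialDeriv (i : Fin 3) (f : E3 → ℝ) (x : E3) : ℝ :=
  fderiv ℝ f x (EuclideanSpace.single i 1)

/-- The classical gradient of a scalar function. -/
noncomputable def grad (f : E3 → ℝ) (x : E3) : E3 :=
  !₂[partialDeriv 0 f x, partialDeriv 1 f x, partialDeriv 2 f x]

/-- The classical curl of a vector field. -/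
noncomputable def curl (ψ : E3 → E3) (x : E3) : E3 :=
  !₂[partialDeriv 1 (fun y => ψ y 2) x - partialDeriv 2 (fun y => ψ y 1) x,
     partialDeriv 2 (fun y => ψ y 0) x - partialDeriv 0 (fun y => ψ y 2) x,
     partialDeriv 0 (fun y => ψ y 1) x - partialDeriv 1 (fun y => ψ y 0) x]

/-- A bounded smooth domain in `ℝ³`: a bounded, nonempty, connected open set which near each of its
boundary points lies on one side of a smooth surface, i.e. is the negativity set of a smooth local
defining function with non-vanishing differential. -/
structure IsBoundedSmoothDomain (Ω : Set E3) : Prop where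
  isOpen : IsOpen Ω
  isConnected : IsConnected Ω
  isBounded : Bornology.IsBounded Ω
  smooth_boundary : ∀ x ∈ frontier Ω, ∃ (U : Set E3) (ρ : E3 → ℝ),
    IsOpen U ∧ x ∈ U ∧ ContDiffOn ℝ ∞ ρ U ∧ fderiv ℝ ρ x ≠ 0 ∧
      Ω ∩ U = {y | y ∈ U ∧ ρ y < 0}

/-- Test functions `C_c^∞(Ω, F)`. -/
def IsTestFunction {F : Type*} [NormedAddCommGroup F] [NormedSpace ℝ F]
    (Ω : Set E3) (φ : E3 → F) : Prop :=
  ContDiff ℝ ∞ φ ∧ HasCompactSupport φ ∧ tsupport φ ⊆ Ω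

/-- `u ∈ H¹(Ω)` with weak gradient `g`: both are square integrable on `Ω`, and
`∫_Ω u ∂ᵢφ = - ∫_Ω gᵢ φ` for all test functions `φ`. Only the values on `Ω` matter. -/
structure IsH1With (Ω : Set E3) (u : E3 → ℝ) (g : E3 → E3) : Prop where
  memLp : MemLp u 2 (volume.restrict Ω)
  memLp_grad : MemLp g 2 (volume.restrict Ω)
  weak_grad : ∀ φ : E3 → ℝ, IsTestFunction Ω φ → ∀ i : Fin 3,
    ∫ x in Ω, u x * partialDeriv i φ x = - ∫ x in Ω, g x i * φ x

/-- The Sobolev space `H¹(Ω)` (as a predicate on representatives). -/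
def MemH1 (Ω : Set E3) (u : E3 → ℝ) : Prop :=
  ∃ g : E3 → E3, IsH1With Ω u g

/-- The space of harmonic Neumann fields on `Ω`: vector fields of class `H¹(Ω, ℝ³)` which are
div-free and tangent to `∂Ω` (weakly: `L²`-orthogonal to the gradients of all `H¹` functions) and
weakly curl-free. -/
structure IsHarmonicNeumannField (Ω : Set E3) (Γ : E3 → E3) : Prop where
  memH1 : ∀ i : Fin 3, MemH1 Ω (fun x => Γ x i)
  divFree_tangent : ∀ (f : E3 → ℝ) (g : E3 → E3), IsH1With Ω f g →
    ∫ x in Ω, inner ℝ (Γ x) (g x) = 0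
  curlFree : ∀ ψ : E3 → E3, IsTestFunction Ω ψ → ∫ x in Ω, inner ℝ (Γ x) (curl ψ x) = 0

/-- The surface area measure on `∂Ω` (two-dimensional Hausdorff measure with the Euclidean
normalisation). -/
noncomputable def surfaceMeasure (Ω : Set E3) : Measure E3 :=
  (Measure.euclideanHausdorffMeasure 2 : Measure E3).restrict (frontier Ω)

/-- `γ ∈ L²(∂Ω)` is the boundary trace of `u ∈ H¹(Ω)`. The trace operator is the continuous
extension to `H¹(Ω)` of the restriction map `v ↦ v|_{∂Ω}`, defined on functions smooth up to the
boundary: there are smooth functions `vₙ` with `vₙ → u` in `H¹(Ω)` and `vₙ|_{∂Ω} → γ`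
in `L²(∂Ω)`. -/
def IsTrace (Ω : Set E3) (u γ : E3 → ℝ) : Prop :=
  MemLp γ 2 (surfaceMeasure Ω) ∧
  ∃ (g : E3 → E3) (v : ℕ → E3 → ℝ), IsH1With Ω u g ∧ (∀ n, ContDiff ℝ ∞ (v n)) ∧
    Tendsto (fun n => eLpNorm (fun x => v n x - u x) 2 (volume.restrict Ω)) atTop (𝓝 0) ∧
    Tendsto (fun n => eLpNorm (fun x => grad (v n) x - g x) 2 (volume.restrict Ω)) atTop (𝓝 0) ∧
    Tendsto (fun n => eLpNorm (fun x => v n x - γ x) 2 (surfaceMeasure Ω)) atTop (𝓝 0)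

/-- The boundary trace of a vector field of class `H¹(Ω, ℝ³)`, taken componentwise. -/
def IsVectorTrace (Ω : Set E3) (Γ G : E3 → E3) : Prop :=
  ∀ i : Fin 3, IsTrace Ω (fun x => Γ x i) (fun x => G x i)

end HarmonicNeumann

/-! A Pohozaev-type identity is played against the maximum principle. Curl-freeness makes the weak
Jacobian of `Γ` symmetric, so testing against the gradient of `xᵢ Γᵢ` gives `∑ⱼ ∫ xᵢ Γⱼ ∂ᵢΓⱼ = -∫
Γᵢ²` (`IsHarmonicNeumannField.sum_integral_coord_mul_eq_zero`). Since `|Γ|² - c` vanishes on `∂Ω`,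
the integral of `∂ᵢ(xᵢ (|Γ|² - c))` is zero, that is `∫ |Γ|² + 2 ∑ⱼ ∫ xᵢ Γⱼ ∂ᵢΓⱼ = c |Ω|`
(`sum_integral_sq_add_eq`). Summing over `i` yields `∫ |Γ|² = 3 c |Ω|`. On the other hand every `Γ ·
b` is weakly harmonic with trace at most `√c |b|`, so `|Γ|² ≤ c` almost everywhere
(`H1Approx.ae_le_of_trace_le`) and `∫ |Γ|² ≤ c |Ω|`. As `|Ω| > 0`, this forces `c = 0`, and then `Γ
= 0`.

The trace is an `L²(∂Ω)` limit of restrictions of smooth functions, and all boundary information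
enters through one estimate, `|∫_Ω ∂ₐ f| ≤ C ∫_{∂Ω} |f|` for `f` of class `C¹`
(`exists_enorm_setIntegral_fderiv_le`). It takes the place of the divergence theorem: no normal and
no surface parametrisation is needed, only slicing by lines transversal to `∂Ω`.

For the maximum principle, let `ψ` be the smooth truncation `expNegInvGlue`. The estimate shows that
`ψ(u - s)`, extended by zero, has a weak gradient `ψ'(u - s) ∇u` on the whole space. Comparing it
with its translates out of `Ω` bounds its `L²` norm on the boundary strip of width `δ` by `C δ`
(`exists_eLpNorm_strip_le`). This compensates the gradient `O(1/δ)` of a cutoff, so harmonicity can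
be tested with `ψ(u - s)` itself: `∫ ψ'(u - s) |∇u|² = 0`. The extension then has zero gradient on
the whole space and vanishes outside `Ω`, hence is zero. -/

namespace HarmonicNeumann

/-! ### Boundary estimate for integrals of derivatives, by slicing -/

open Set in
/-- On a line, the integral of a derivative over a sublevel set of a strictly increasing function is
zero or the value at the zero of that function. -/
lemma integral_indicator_deriv_eq_zero_or {p q : ℝ → ℝ} {J A : Set ℝ} (hp : ContDiff ℝ 1 p)
    (hpc : HasCompactSupport p) (hpJ : tsupport p ⊆ J) (hJ : J.OrdConnected)
    (hq : ContinuousOn q J) (hmono : StrictMonoOn q J) (hA : ∀ t ∈ J, (t ∈ A ↔ q t < 0)) :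
    ∫ t, A.indicator (deriv p) t = 0 ∨
      ∃ t ∈ J, q t = 0 ∧ ∫ t, A.indicator (deriv p) t = p t := by
  have hoff : ∀ t, t ∉ J → deriv p t = 0 := fun t ht =>
    image_eq_zero_of_notMem_tsupport fun h => ht (hpJ (tsupport_deriv_subset h))
  by_cases h1 : ∃ t₁ ∈ J, q t₁ < 0
  · by_cases h2 : ∃ t₂ ∈ J, 0 ≤ q t₂
    · right
      obtain ⟨t₁, ht₁, hq₁⟩ := h1
      obtain ⟨t₂, ht₂, hq₂⟩ := h2
      have h12 : t₁ < t₂ := (hmono.lt_iff_lt ht₁ ht₂).1 (hq₁.trans_le hq₂)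
      obtain ⟨t, ht, hqt⟩ := intermediate_value_Icc h12.le (hq.mono (hJ.out ht₁ ht₂))
        ⟨hq₁.le, hq₂⟩
      have htJ : t ∈ J := hJ.out ht₁ ht₂ ht
      refine ⟨t, htJ, hqt, ?_⟩
      -- Monotonicity makes `A` coincide with the half-line below `t` inside `J`; outside `J` the
      -- derivative vanishes anyway.
      have hind : A.indicator (deriv p) = (Iio t).indicator (deriv p) := by
        funext r
        by_cases hr : r ∈ J
        · have : r ∈ A ↔ r ∈ Iio t := by
            rw [hA r hr, ← hqt, hmono.lt_iff_lt hr htJ, mem_Iio]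
          by_cases hrA : r ∈ A
          · rw [indicator_of_mem hrA, indicator_of_mem (this.1 hrA)]
          · rw [indicator_of_notMem hrA, indicator_of_notMem (fun h => hrA (this.2 h))]
        · simp [indicator, hoff r hr]
      rw [hind, integral_indicator measurableSet_Iio, ← integral_Iic_eq_integral_Iio,
        hpc.integral_Iic_deriv_eq hp]
    · left
      have hind : A.indicator (deriv p) = deriv p := by
        funext r
        by_cases hr : r ∈ J
        · exact indicator_of_mem ((hA r hr).2 (not_le.1 fun h => h2 ⟨r, hr, h⟩)) _
        · simp [indicator, hoff r hr]
      rw [hind]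
      -- Here all of `J` lies in `A`; the fundamental theorem is evaluated at `b + 1`, strictly
      -- beyond the support, where `p` is zero.
      obtain ⟨b, hb⟩ := hpc.isCompact.bddAbove
      have := hpc.integral_Iic_deriv_eq hp (b + 1)
      rw [image_eq_zero_of_notMem_tsupport (fun h => absurd (hb h) (by simp))] at this
      rw [← this, setIntegral_eq_integral_of_forall_compl_eq_zero]
      intro r hr
      refine image_eq_zero_of_notMem_tsupport fun h => hr ?_
      have := hb (tsupport_deriv_subset h)
      simp only [mem_Iic]; linarith
  · left
    have hind : A.indicator (deriv p) = 0 := by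
      funext r
      by_cases hr : r ∈ J
      · exact indicator_of_notMem (fun h => h1 ⟨r, hr, (hA r hr).1 h⟩) _
      · simp [indicator, hoff r hr]
    simp [hind]

/-- A complement of the line spanned by `e` is a plane. These coordinates, in general not
orthogonal, turn `∂ₑ` into the derivative in the last variable. -/
lemma exists_equiv_prod_of_ne_zero {e : E3} (he : e ≠ 0) :
    ∃ L : (EuclideanSpace ℝ (Fin 2) × ℝ) ≃L[ℝ] E3, L (0, 1) = e := by
  obtain ⟨W, hW⟩ := Submodule.exists_isCompl (Submodule.span ℝ {e})
  have hfin : Module.finrank ℝ W = 2 := by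
    have h1 := Submodule.finrank_add_eq_of_isCompl hW
    rw [finrank_span_singleton he] at h1
    have : Module.finrank ℝ E3 = 3 := by simp
    omega
  let ι : EuclideanSpace ℝ (Fin 2) ≃ₗ[ℝ] W := LinearEquiv.ofFinrankEq _ _ (by simp [hfin])
  let κ : ℝ ≃ₗ[ℝ] Submodule.span ℝ {e} := LinearEquiv.toSpanNonzeroSingleton ℝ E3 e he
  let M := (ι.prodCongr κ).trans (Submodule.prodEquivOfIsCompl W _ hW.symm)
  refine ⟨M.toContinuousLinearEquiv, ?_⟩
  change M (0, 1) = e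
  simp [M, κ, ι]

/-- Fubini in linear coordinates. -/
lemma exists_integral_eq_smul_integral_integral (L : (EuclideanSpace ℝ (Fin 2) × ℝ) ≃L[ℝ] E3) :
    ∃ k : ℝ, ∀ F : E3 → ℝ, Integrable F →
      Integrable (fun y => ∫ t, F (L (y, t))) ∧ ∫ x, F x = k * ∫ y, ∫ t, F (L (y, t)) := by
  let μ : Measure (EuclideanSpace ℝ (Fin 2) × ℝ) := (volume : Measure E3).map L.symm
  have : μ.IsAddHaarMeasure := L.symm.isAddHaarMeasure_map volume
  have : (volume : Measure (EuclideanSpace ℝ (Fin 2) × ℝ)).IsAddHaarMeasure :=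
    Measure.prod.instIsAddHaarMeasure volume volume
  -- By uniqueness of Haar measure the linear change of variables costs only a constant factor,
  -- whose value is irrelevant.
  have hμ := Measure.isAddLeftInvariant_eq_smul μ
    (volume : Measure (EuclideanSpace ℝ (Fin 2) × ℝ))
  have hc := (Measure.addHaarScalarFactor_pos_of_isAddHaarMeasure μ
    (volume : Measure (EuclideanSpace ℝ (Fin 2) × ℝ))).ne'
  set c := Measure.addHaarScalarFactor μ (volume : Measure (EuclideanSpace ℝ (Fin 2) × ℝ))
  have hme : MeasurableEmbedding L.symm := L.symm.toHomeomorph.measurableEmbedding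
  refine ⟨c, fun F hF => ?_⟩
  have h1 : Integrable (fun z => F (L z)) μ := by
    rw [hme.integrable_map_iff]
    simpa [Function.comp_def] using hF
  have h2 : Integrable (fun z => F (L z)) (volume : Measure (EuclideanSpace ℝ (Fin 2) × ℝ)) := by
    rw [hμ] at h1
    exact (integrable_smul_measure (by simpa using hc) (by simp)).1
      (show Integrable _ ((c : ENNReal) • _) from h1)
  refine ⟨h2.integral_prod_left, ?_⟩
  have h3 : ∫ x, F x = ∫ z, F (L z) ∂μ := by
    rw [hme.integral_map]; simp
  rw [h3, hμ, integral_smul_nnreal_measure, NNReal.smul_def, smul_eq_mul,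
    Measure.volume_eq_prod, integral_prod]
  rwa [← Measure.volume_eq_prod]

/-- Lebesgue measure on the plane is the two-dimensional Hausdorff measure with the same normalising
constant as on `E3`, so the constant passes through the Lipschitz bound. -/
lemma volume_image_le_euclideanHausdorffMeasure {K : NNReal} {π : E3 → EuclideanSpace ℝ (Fin 2)}
    (hπ : LipschitzWith K π) (A : Set E3) :
    volume (π '' A) ≤ K ^ 2 * Measure.euclideanHausdorffMeasure 2 A := by
  rw [← EuclideanSpace.euclideanHausdorffMeasure_eq_volume,
    Measure.euclideanHausdorffMeasure_def, Measure.euclideanHausdorffMeasure_def,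
    Measure.smul_apply, Measure.smul_apply, ENNReal.smul_def, ENNReal.smul_def, smul_eq_mul,
    smul_eq_mul, mul_left_comm]
  gcongr
  simpa using hπ.hausdorffMeasure_image_le (d := 2) (by norm_num) A

/-- The functional `f ↦ ∫_Ω ∂ₐ f`, restricted to functions supported in `V`, is controlled by the
surface integral. -/
def HasBoundaryBoundOn (Ω : Set E3) (a : E3) (V : Set E3) : Prop :=
  ∃ C : NNReal, ∀ f : E3 → ℝ, ContDiff ℝ 1 f → HasCompactSupport f → tsupport f ⊆ V →
    ‖∫ x in Ω, fderiv ℝ f x a‖ₑ ≤ C * ∫⁻ x, ‖f x‖ₑ ∂surfaceMeasure Ω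

/-- Slicing only handles directions transversal to the boundary; differences of such directions
reach the tangential ones. -/
lemma HasBoundaryBoundOn.sub {Ω V₁ V₂ : Set E3} {a b : E3} (ha : HasBoundaryBoundOn Ω a V₁)
    (hb : HasBoundaryBoundOn Ω b V₂) : HasBoundaryBoundOn Ω (a - b) (V₁ ∩ V₂) := by
  obtain ⟨C, hC⟩ := ha
  obtain ⟨D, hD⟩ := hb
  refine ⟨C + D, fun f hf hfc hfV => ?_⟩
  have hint : ∀ c : E3, Integrable (fun x => fderiv ℝ f x c) (volume.restrict Ω) := fun c =>
    (((hf.continuous_fderiv (by simp)).clm_apply continuous_const).integrable_of_hasCompactSupport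
      (hfc.fderiv_apply (𝕜 := ℝ) c)).integrableOn
  have h1 := hC f hf hfc (hfV.trans Set.inter_subset_left)
  have h2 := hD f hf hfc (hfV.trans Set.inter_subset_right)
  simp only [map_sub]
  rw [integral_sub (hint a) (hint b)]
  calc _ ≤ _ := enorm_sub_le
    _ ≤ _ := add_le_add h1 h2
    _ = _ := by push_cast; ring

lemma lipschitzWith_fst_comp_symm (L : (EuclideanSpace ℝ (Fin 2) × ℝ) ≃L[ℝ] E3) :
    ∃ K, LipschitzWith K (fun x => (L.symm x).1) :=
  ⟨_, ((ContinuousLinearMap.fst ℝ (EuclideanSpace ℝ (Fin 2)) ℝ).comp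
    (L.symm : E3 →L[ℝ] EuclideanSpace ℝ (Fin 2) × ℝ)).lipschitz⟩

/-- The slicing estimate in a ball where the defining function increases in direction `e`. -/
lemma hasBoundaryBoundOn_ball {Ω : Set E3} (hΩ : IsOpen Ω) {x₀ e : E3} {r : ℝ} {ρ : E3 → ℝ}
    (hρ : ∀ x ∈ Metric.ball x₀ r, DifferentiableAt ℝ ρ x)
    (hpos : ∀ x ∈ Metric.ball x₀ r, 0 < fderiv ℝ ρ x e)
    (hΩρ : ∀ x ∈ Metric.ball x₀ r, (x ∈ Ω ↔ ρ x < 0)) :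
    HasBoundaryBoundOn Ω e (Metric.ball x₀ r) := by
  by_cases he : e = 0
  · refine ⟨0, fun f _ _ _ => ?_⟩
    simp [he]
  obtain ⟨L, hL⟩ := exists_equiv_prod_of_ne_zero he
  obtain ⟨k, hk⟩ := exists_integral_eq_smul_integral_integral L
  obtain ⟨K, hK⟩ := lipschitzWith_fst_comp_symm L
  refine ⟨‖k‖₊ * K ^ 2, fun f hf hfc hfV => ?_⟩
  have hLt : ∀ y t, L (y, t) = L (y, 0) + t • e := fun y t => by
    rw [← hL, ← map_smul, ← map_add, Prod.smul_mk, Prod.mk_add_mk, smul_zero, add_zero, zero_add,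
      smul_eq_mul, mul_one]
  have hderiv : ∀ (g : E3 → ℝ) y t, DifferentiableAt ℝ g (L (y, t)) →
      HasDerivAt (fun s => g (L (y, s))) (fderiv ℝ g (L (y, t)) e) t := by
    intro g y t hg
    have h1 : HasDerivAt (fun s => L (y, s)) e t := by
      rw [funext (hLt y)]
      simpa only [one_smul, id] using ((hasDerivAt_id t).smul_const e).const_add (L (y, 0))
    exact hg.hasFDerivAt.comp_hasDerivAt t h1
  set F : E3 → ℝ := Ω.indicator fun x => fderiv ℝ f x e with hF
  have hFint : Integrable F :=
    (((hf.continuous_fderiv (by simp)).clm_apply continuous_const).integrable_of_hasCompactSupport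
      (hfc.fderiv_apply (𝕜 := ℝ) e)).indicator hΩ.measurableSet
  obtain ⟨hint, heq⟩ := hk F hFint
  set H : EuclideanSpace ℝ (Fin 2) → ℝ := fun y => ∫ t, F (L (y, t)) with hH
  -- Within the ball `ρ` strictly increases along each line, so the line leaves `Ω` at most once,
  -- and its contribution is zero or the value of `f` at the exit point.
  have hslice : ∀ y, H y = 0 ∨ ∃ x ∈ frontier Ω, (L.symm x).1 = y ∧ H y = f x := by
    intro y
    have hcL : Continuous fun t => L (y, t) := by fun_prop
    have hpre : tsupport (fun t => f (L (y, t))) ⊆ (fun t => L (y, t)) ⁻¹' tsupport f :=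
      tsupport_comp_subset_preimage f hcL
    have hp : ContDiff ℝ 1 fun t => f (L (y, t)) := by fun_prop
    have hpc : HasCompactSupport fun t => f (L (y, t)) := by
      refine HasCompactSupport.of_support_subset_isCompact
        (K := (fun x => (L.symm x).2) '' tsupport f) (hfc.isCompact.image (by fun_prop)) ?_
      intro t ht
      exact ⟨L (y, t), subset_tsupport _ ht, by simp⟩
    have hd : ∀ t, deriv (fun t => f (L (y, t))) t = fderiv ℝ f (L (y, t)) e := fun t =>
      (hderiv f y t (hf.differentiable (by simp) _)).deriv
    have hconv : Convex ℝ ((fun t => L (y, t)) ⁻¹' Metric.ball x₀ r) := by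
      intro s hs t ht α β hα hβ hαβ
      have : L (y, α • s + β • t) = α • L (y, s) + β • L (y, t) := by
        rw [← map_smul, ← map_smul, ← map_add]
        congr 1
        ext1
        · simp [← add_smul, hαβ]
        · simp
      simp only [Set.mem_preimage, this]
      exact convex_ball x₀ r hs ht hα hβ hαβ
    have hopen : IsOpen ((fun t => L (y, t)) ⁻¹' Metric.ball x₀ r) :=
      Metric.isOpen_ball.preimage hcL
    have hqd : ∀ t ∈ (fun t => L (y, t)) ⁻¹' Metric.ball x₀ r,
        HasDerivAt (fun t => ρ (L (y, t))) (fderiv ℝ ρ (L (y, t)) e) t := fun t ht =>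
      hderiv ρ y t (hρ _ ht)
    have hq : ContinuousOn (fun t => ρ (L (y, t))) ((fun t => L (y, t)) ⁻¹' Metric.ball x₀ r) :=
      fun t ht => (hqd t ht).continuousAt.continuousWithinAt
    have hmono : StrictMonoOn (fun t => ρ (L (y, t)))
        ((fun t => L (y, t)) ⁻¹' Metric.ball x₀ r) :=
      strictMonoOn_of_deriv_pos hconv hq fun t ht => by
        rw [hopen.interior_eq] at ht
        rw [(hqd t ht).deriv]
        exact hpos _ ht
    have hHy : H y = ∫ t, ((fun t => L (y, t)) ⁻¹' Ω).indicator
        (deriv fun t => f (L (y, t))) t := by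
      refine integral_congr_ae (.of_forall fun t => ?_)
      simp only [hF, Set.indicator, hd]
      rfl
    rcases integral_indicator_deriv_eq_zero_or (A := (fun t => L (y, t)) ⁻¹' Ω) hp hpc
      (hpre.trans (Set.preimage_mono hfV)) hconv.ordConnected hq hmono
      (fun t ht => hΩρ _ ht) with h | ⟨t, ht, hqt, h⟩
    · left; rw [hHy, h]
    · right
      refine ⟨L (y, t), ?_, by simp, by rw [hHy, h]⟩
      rw [hΩ.frontier_eq]
      refine ⟨?_, fun hmem => ?_⟩
      -- The exit point is a limit of points lower on the line, where `ρ < 0`.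
      · have hT : Tendsto (fun s => L (y, s)) (𝓝[<] t) (𝓝 (L (y, t))) :=
          hcL.continuousAt.tendsto.mono_left nhdsWithin_le_nhds
        refine mem_closure_of_tendsto hT ?_
        filter_upwards [self_mem_nhdsWithin, nhdsWithin_le_nhds (hopen.mem_nhds ht)] with s hs hsJ
        rw [hΩρ _ hsJ, ← hqt]
        exact hmono hsJ ht hs
      · have := (hΩρ _ ht).1 hmem
        exact absurd hqt this.ne
  -- Comparing superlevel sets and then using the layer-cake formula avoids choosing the exit point
  -- measurably in `y`.
  have hmeas : ∀ s : ℝ, 0 < s → volume {y | s < ‖H y‖} ≤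
      K ^ 2 * surfaceMeasure Ω {x | s < ‖f x‖} := by
    intro s hs
    have hsub : {y | s < ‖H y‖} ⊆
        (fun x => (L.symm x).1) '' ({x | s < ‖f x‖} ∩ frontier Ω) := by
      intro y hy
      rcases hslice y with h | ⟨x, hx, hxy, h⟩
      · simp only [Set.mem_ofPred_eq, h, norm_zero] at hy
        exact absurd hy hs.not_gt
      · exact ⟨x, ⟨by simpa [h] using hy, hx⟩, hxy⟩
    calc _ ≤ _ := measure_mono hsub
      _ ≤ _ := volume_image_le_euclideanHausdorffMeasure hK _
      _ ≤ _ := mul_le_mul_right (Measure.le_restrict_apply _ _) _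
  have hlayer : ∫⁻ y, ‖H y‖ₑ ≤ K ^ 2 * ∫⁻ x, ‖f x‖ₑ ∂surfaceMeasure Ω := by
    simp_rw [← ofReal_norm]
    rw [lintegral_eq_lintegral_meas_lt _ (.of_forall fun _ => norm_nonneg _)
        hint.aestronglyMeasurable.norm.aemeasurable,
      lintegral_eq_lintegral_meas_lt _ (.of_forall fun _ => norm_nonneg _)
        hf.continuous.norm.aemeasurable,
      ← lintegral_const_mul' _ _ (by simp)]
    exact setLIntegral_mono' measurableSet_Ioi hmeas
  rw [← integral_indicator hΩ.measurableSet, heq, enorm_mul]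
  calc _ ≤ ‖k‖ₑ * ∫⁻ y, ‖H y‖ₑ := by gcongr; exact enorm_integral_le_lintegral_enorm _
    _ ≤ ‖k‖ₑ * (K ^ 2 * ∫⁻ x, ‖f x‖ₑ ∂surfaceMeasure Ω) := by gcongr
    _ = _ := by rw [← mul_assoc]; simp [enorm_eq_nnnorm]

lemma HasBoundaryBoundOn.mono {Ω V W : Set E3} {a : E3} (h : HasBoundaryBoundOn Ω a W)
    (hVW : V ⊆ W) : HasBoundaryBoundOn Ω a V := by
  obtain ⟨C, hC⟩ := h
  exact ⟨C, fun f hf hfc hfV => hC f hf hfc (hfV.trans hVW)⟩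

/-- Near a boundary point the domain is a sublevel set in a ball. -/
lemma IsBoundedSmoothDomain.exists_ball {Ω : Set E3} (hΩ : IsBoundedSmoothDomain Ω) {x₀ : E3}
    (hx₀ : x₀ ∈ frontier Ω) : ∃ (ρ : E3 → ℝ) (r : ℝ), 0 < r ∧
      (∀ x ∈ Metric.ball x₀ r, DifferentiableAt ℝ ρ x) ∧
      ContinuousOn (fderiv ℝ ρ) (Metric.ball x₀ r) ∧ fderiv ℝ ρ x₀ ≠ 0 ∧
      ∀ x ∈ Metric.ball x₀ r, (x ∈ Ω ↔ ρ x < 0) := by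
  obtain ⟨U, ρ, hU, hxU, hρ, hne, heq⟩ := hΩ.smooth_boundary x₀ hx₀
  obtain ⟨r, hr, hball⟩ := Metric.isOpen_iff.1 hU x₀ hxU
  refine ⟨ρ, r, hr, fun x hx => ?_, ?_, hne, fun x hx => ?_⟩
  · exact (hρ.contDiffAt (hU.mem_nhds (hball hx))).differentiableAt (by simp)
  · exact (hρ.continuousOn_fderiv_of_isOpen hU (by simp)).mono hball
  · have : x ∈ Ω ∩ U ↔ x ∈ {y | y ∈ U ∧ ρ y < 0} := by rw [heq]
    simpa [hball hx] using this

/-- Any direction is a difference `(a + k e) - k e` of two directions in which `ρ` increases near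
`x₀`. -/
lemma exists_hasBoundaryBoundOn_frontier {Ω : Set E3} (hΩ : IsBoundedSmoothDomain Ω) {x₀ : E3}
    (hx₀ : x₀ ∈ frontier Ω) (a : E3) : ∃ V, IsOpen V ∧ x₀ ∈ V ∧ HasBoundaryBoundOn Ω a V := by
  obtain ⟨ρ, r, hr, hd, hc, hne, hiff⟩ := hΩ.exists_ball hx₀
  have key : ∀ b : E3, 0 < fderiv ℝ ρ x₀ b →
      ∃ V, IsOpen V ∧ x₀ ∈ V ∧ HasBoundaryBoundOn Ω b V := by
    intro b hb
    have hcb : ContinuousAt (fun x => fderiv ℝ ρ x b) x₀ :=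
      (hc.continuousAt (Metric.ball_mem_nhds x₀ hr)).clm_apply continuousAt_const
    obtain ⟨s, hs, hsub⟩ := Metric.mem_nhds_iff.1
      (inter_mem (hcb.eventually (lt_mem_nhds hb)) (Metric.ball_mem_nhds x₀ hr))
    exact ⟨Metric.ball x₀ s, Metric.isOpen_ball, Metric.mem_ball_self hs,
      hasBoundaryBoundOn_ball hΩ.isOpen (fun x hx => hd x (hsub hx).2) (fun x hx => (hsub hx).1)
        fun x hx => hiff x (hsub hx).2⟩
  obtain ⟨e, he⟩ : ∃ e, 0 < fderiv ℝ ρ x₀ e := by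
    obtain ⟨e, he⟩ : ∃ e, fderiv ℝ ρ x₀ e ≠ 0 := by
      by_contra! h
      exact hne (ContinuousLinearMap.ext h)
    rcases he.lt_or_gt with h | h
    · exact ⟨-e, by simpa using h⟩
    · exact ⟨e, h⟩
  obtain ⟨k, hk, hka⟩ : ∃ k : ℝ, 0 < k ∧ 0 < fderiv ℝ ρ x₀ (a + k • e) := by
    -- Large enough that the increase along `k e` outweighs any decrease along `a`.
    refine ⟨|fderiv ℝ ρ x₀ a| / fderiv ℝ ρ x₀ e + 1, by positivity, ?_⟩
    have := neg_abs_le (fderiv ℝ ρ x₀ a)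
    simp only [map_add, map_smul, smul_eq_mul, add_mul, div_mul_cancel₀ _ he.ne', one_mul]
    linarith
  obtain ⟨V₁, hV₁, hx₁, h₁⟩ := key _ hka
  obtain ⟨V₂, hV₂, hx₂, h₂⟩ := key (k • e) (by simpa using mul_pos hk he)
  exact ⟨V₁ ∩ V₂, hV₁.inter hV₂, ⟨hx₁, hx₂⟩, by simpa using h₁.sub h₂⟩

lemma integral_fderiv_apply_eq_zero {f : E3 → ℝ} (hf : ContDiff ℝ 1 f) (hfc : HasCompactSupport f)
    (a : E3) : ∫ x, fderiv ℝ f x a = 0 := by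
  have h := integral_mul_fderiv_eq_neg_fderiv_mul_of_integrable (μ := (volume : Measure E3))
    (f := fun _ : E3 => (1 : ℝ)) (g := f) (v := a) (by simp)
    (by simpa using ((hf.continuous_fderiv (by simp)).clm_apply
      continuous_const).integrable_of_hasCompactSupport (hfc.fderiv_apply (𝕜 := ℝ) a))
    (by simpa using hf.continuous.integrable_of_hasCompactSupport hfc)
    (fun _ _ => differentiableAt_const _) (fun x _ => hf.differentiable (by simp) x)
  simpa using h

lemma setIntegral_fderiv_apply_eq_zero {Ω : Set E3} {f : E3 → ℝ} (hf : ContDiff ℝ 1 f)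
    (hfc : HasCompactSupport f) (hfΩ : tsupport f ⊆ Ω) (a : E3) :
    ∫ x in Ω, fderiv ℝ f x a = 0 := by
  rw [setIntegral_eq_integral_of_forall_compl_eq_zero, integral_fderiv_apply_eq_zero hf hfc]
  intro x hx
  have : fderiv ℝ f x = 0 :=
    image_eq_zero_of_notMem_tsupport fun h => hx (hfΩ (tsupport_fderiv_subset ℝ h))
  simp [this]

/-- The integral of a derivative over the domain is controlled by the surface integral. -/
theorem exists_enorm_setIntegral_fderiv_le {Ω : Set E3} (hΩ : IsBoundedSmoothDomain Ω) (a : E3) :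
    ∃ C : NNReal, ∀ f : E3 → ℝ, ContDiff ℝ 1 f →
      ‖∫ x in Ω, fderiv ℝ f x a‖ₑ ≤ C * ∫⁻ x, ‖f x‖ₑ ∂surfaceMeasure Ω := by
  have hloc : ∀ x ∈ closure Ω, ∃ V, IsOpen V ∧ x ∈ V ∧ Bornology.IsBounded V ∧
      HasBoundaryBoundOn Ω a V := by
    intro x hx
    suffices h : ∃ V, IsOpen V ∧ x ∈ V ∧ HasBoundaryBoundOn Ω a V by
      obtain ⟨V, hV, hxV, h⟩ := h
      -- Bounded patches make the pieces `χᵢ f` compactly supported, although `f` need not be.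
      exact ⟨V ∩ Metric.ball x 1, hV.inter Metric.isOpen_ball, ⟨hxV, by simp⟩,
        Metric.isBounded_ball.subset Set.inter_subset_right, h.mono Set.inter_subset_left⟩
    by_cases hxΩ : x ∈ Ω
    · refine ⟨Ω, hΩ.isOpen, hxΩ, 0, fun f hf hfc hfΩ => ?_⟩
      simp [setIntegral_fderiv_apply_eq_zero hf hfc hfΩ]
    · exact exists_hasBoundaryBoundOn_frontier hΩ (hΩ.isOpen.frontier_eq ▸ ⟨hx, hxΩ⟩) a
  choose! V hVo hxV hVb hV using hloc
  have hcomp : IsCompact (closure Ω) := hΩ.isBounded.isCompact_closure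
  obtain ⟨t, htsub, hcover⟩ := hcomp.elim_nhds_subcover V
    fun x hx => (hVo x hx).mem_nhds (hxV x hx)
  obtain ⟨χ, hχ⟩ := SmoothPartitionOfUnity.exists_isSubordinate (modelWithCornersSelf ℝ E3)
    (isClosed_closure (s := Ω)) (fun i : t => V i) (fun i => hVo i (htsub i i.2)) (by
      intro x hx
      obtain ⟨i, hi, hxi⟩ := Set.mem_iUnion₂.1 (hcover hx)
      exact Set.mem_iUnion.2 ⟨⟨i, hi⟩, hxi⟩)
  choose C hC using fun i : t => hV i (htsub i i.2)
  refine ⟨∑ i, C i, fun f hf => ?_⟩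
  have hχd : ∀ i, ContDiff ℝ 1 (χ i) := fun i => (χ i).contMDiff.contDiff.of_le (by simp)
  have hprod : ∀ i, ContDiff ℝ 1 (fun x => χ i x * f x) := fun i => (hχd i).mul hf
  have hts : ∀ i, tsupport (fun x => χ i x * f x) ⊆ V i := fun i =>
    (tsupport_mul_subset_left).trans (hχ i)
  have hcs : ∀ i, HasCompactSupport (fun x => χ i x * f x) := fun i =>
    ((hVb i (htsub i i.2)).subset (hts i)).isCompact_closure.of_isClosed_subset
      (isClosed_tsupport _) subset_closure
  have hint : ∀ i, Integrable (fun x => fderiv ℝ (fun x => χ i x * f x) x a)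
      (volume.restrict Ω) := fun i =>
    ((((hprod i).continuous_fderiv (by simp)).clm_apply
      continuous_const).integrable_of_hasCompactSupport
      ((hcs i).fderiv_apply (𝕜 := ℝ) a)).integrableOn
  have hsum : ∀ x ∈ Ω, fderiv ℝ f x a = ∑ i, fderiv ℝ (fun x => χ i x * f x) x a := by
    intro x hx
    have hev : f =ᶠ[𝓝 x] fun x => ∑ i, χ i x * f x := by
      filter_upwards [hΩ.isOpen.mem_nhds hx] with y hy
      have := χ.sum_eq_one (subset_closure hy)
      rw [finsum_eq_sum_of_fintype] at this
      rw [← Finset.sum_mul, this, one_mul]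
    rw [hev.fderiv_eq, fderiv_fun_sum fun i _ => (hprod i).differentiable (by simp) x]
    simp
  rw [setIntegral_congr_fun hΩ.isOpen.measurableSet hsum, integral_finsetSum _ fun i _ => hint i]
  calc _ ≤ ∑ i, ‖∫ x in Ω, fderiv ℝ (fun x => χ i x * f x) x a‖ₑ := enorm_sum_le _ _
    _ ≤ ∑ i, (C i : ENNReal) * ∫⁻ x, ‖f x‖ₑ ∂surfaceMeasure Ω := by
      gcongr with i
      refine (hC i _ (hprod i) (hcs i) (hts i)).trans ?_
      gcongr with x
      rw [enorm_mul]
      refine mul_le_of_le_one_left' ?_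
      rw [Real.enorm_eq_ofReal (χ.nonneg i x), ENNReal.ofReal_le_one]
      exact χ.le_one i x
    _ = _ := by rw [← Finset.sum_mul]; simp

/-! ### Translates and weak derivatives in `L²` -/

/-- An `L²` function is bounded in norm by its pairings with test functions. -/
lemma eLpNorm_le_of_forall_integral_mul_le {D : E3 → ℝ} (hD : MemLp D 2) {M : ENNReal}
    (hM : M ≠ ⊤)
    (h : ∀ φ : E3 → ℝ, ContDiff ℝ ∞ φ → HasCompactSupport φ →
      |∫ x, D x * φ x| ≤ M.toReal * (eLpNorm φ 2).toReal) : eLpNorm D 2 ≤ M := by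
  set D' : Lp ℝ 2 (volume : Measure E3) := hD.toLp D
  have hcl : ∀ φ : Lp ℝ 2 (volume : Measure E3), |inner ℝ D' φ| ≤ M.toReal * ‖φ‖ := by
    intro φ
    refine (Lp.dense_hasCompactSupport_contDiff (F := ℝ) (p := 2) (μ := (volume : Measure E3))
      (by simp)).induction (P := fun φ => |inner ℝ D' φ| ≤ M.toReal * ‖φ‖) ?_
      (isClosed_le (by fun_prop) (by fun_prop)) φ
    rintro φ ⟨g, hφg, hgc, hg⟩
    have h1 : inner ℝ D' φ = ∫ x, D x * g x := by
      rw [L2.inner_def]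
      refine integral_congr_ae ?_
      filter_upwards [hφg, hD.coeFn_toLp] with x hx hx'
      rw [hx, hx']
      simp [mul_comm]
    have h2 : ‖φ‖ = (eLpNorm g 2).toReal := by
      rw [Lp.norm_def, eLpNorm_congr_ae hφg]
    rw [h1, h2]
    exact h g hg hgc
  -- By density the bound holds for every `L²` function, in particular for `D` itself.
  have h1 := hcl D'
  rw [real_inner_self_eq_norm_sq, abs_of_nonneg (by positivity), sq] at h1
  have h2 : ‖D'‖ ≤ M.toReal := by
    rcases (norm_nonneg D').eq_or_lt with h0 | h0
    · rw [← h0]; positivity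
    · exact le_of_mul_le_mul_right h1 h0
  rw [Lp.norm_toLp] at h2
  exact (ENNReal.toReal_le_toReal hD.eLpNorm_ne_top hM).1 h2

/-- `|∫ f g| ≤ ‖f‖₂ ‖g‖₂`. -/
lemma abs_integral_mul_le_eLpNorm {α : Type*} [MeasurableSpace α] {μ : Measure α} {f g : α → ℝ}
    (hf : MemLp f 2 μ) (hg : MemLp g 2 μ) :
    |∫ x, f x * g x ∂μ| ≤ (eLpNorm f 2 μ).toReal * (eLpNorm g 2 μ).toReal := by
  have h1 : inner ℝ (hf.toLp f) (hg.toLp g) = ∫ x, f x * g x ∂μ := by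
    rw [L2.inner_def]
    refine integral_congr_ae ?_
    filter_upwards [hf.coeFn_toLp, hg.coeFn_toLp] with x hx hx'
    rw [hx, hx']
    simp [mul_comm]
  rw [← h1, ← Lp.norm_toLp f hf, ← Lp.norm_toLp g hg]
  exact abs_real_inner_le_norm _ _

/-- The translation is placed on the smooth factor, so no regularity of `f` is needed to
differentiate. -/
lemma hasDerivAt_integral_mul_translate {f φ : E3 → ℝ} (hf : LocallyIntegrable f)
    (hφ : ContDiff ℝ ∞ φ) (hφc : HasCompactSupport φ) (a : E3) (t : ℝ) :
    HasDerivAt (fun s : ℝ => ∫ x, f x * φ (x - s • a))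
      (∫ x, f x * -(fderiv ℝ φ (x - t • a) a)) t := by
  have hdφ : Continuous fun x => fderiv ℝ φ x a :=
    (hφ.continuous_fderiv (by simp)).clm_apply continuous_const
  obtain ⟨C, hC⟩ := hdφ.bounded_above_of_compact_support (hφc.fderiv_apply (𝕜 := ℝ) a)
  -- The compact set swept out by the translated supports for parameters within `1` of `t`; it
  -- carries the dominating function.
  set K : Set E3 := (fun p : ℝ × E3 => p.2 + p.1 • a) '' (Metric.closedBall t 1 ×ˢ tsupport φ)
  have hK : IsCompact K :=
    ((isCompact_closedBall t 1).prod hφc.isCompact).image (by fun_prop)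
  refine (hasDerivAt_integral_of_dominated_loc_of_deriv_le
    (F := fun (s : ℝ) x => f x * φ (x - s • a))
    (F' := fun (s : ℝ) x => f x * -(fderiv ℝ φ (x - s • a) a))
    (bound := K.indicator fun x => ‖f x‖ * C)
    (Metric.closedBall_mem_nhds t one_pos) ?_ ?_ ?_ ?_ ?_ ?_).2
  · refine .of_forall fun s => hf.aestronglyMeasurable.mul ?_
    exact (hφ.continuous.comp (by fun_prop)).aestronglyMeasurable
  · have hcs : HasCompactSupport fun x : E3 => φ (x - t • a) := by
      simpa [sub_eq_add_neg] using! hφc.comp_homeomorph (Homeomorph.addRight (-(t • a)))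
    simpa [mul_comm] using
      hf.integrable_smul_right_of_hasCompactSupport (hφ.continuous.comp (by fun_prop)) hcs
  · exact hf.aestronglyMeasurable.mul (hdφ.comp (by fun_prop)).neg.aestronglyMeasurable
  · refine .of_forall fun x s hs => ?_
    by_cases hx : x ∈ K
    · rw [Set.indicator_of_mem hx, norm_mul, norm_neg]
      gcongr
      exact hC _
    · rw [Set.indicator_of_notMem hx]
      have : x - s • a ∉ tsupport φ := fun h => hx ⟨(s, x - s • a), ⟨hs, h⟩, by simp⟩
      have h0 : fderiv ℝ φ (x - s • a) = 0 :=
        image_eq_zero_of_notMem_tsupport fun h => this (tsupport_fderiv_subset ℝ h)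
      simp [h0]
  · rw [integrable_indicator_iff hK.measurableSet]
    exact (hf.integrableOn_isCompact hK).norm.mul_const C
  · refine .of_forall fun x s _ => ?_
    have h1 : HasDerivAt (fun s : ℝ => x - s • a) (-a) s := by
      simpa using ((hasDerivAt_id s).smul_const a).const_sub x
    have h2 := (hφ.differentiable (by simp) (x - s • a)).hasFDerivAt.comp_hasDerivAt s h1
    simpa using h2.const_mul (f x)

/-- Translates of a function with a weak directional derivative in `L²`. -/
theorem eLpNorm_translate_sub_le {f h : E3 → ℝ} (hf : MemLp f 2) (hh : MemLp h 2) {a : E3}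
    (hweak : ∀ φ : E3 → ℝ, ContDiff ℝ ∞ φ → HasCompactSupport φ →
      ∫ x, f x * fderiv ℝ φ x a = -∫ x, h x * φ x) :
    eLpNorm (fun x => f (x + a) - f x) 2 ≤ eLpNorm h 2 := by
  have hmp := measurePreserving_add_right (volume : Measure E3) a
  have hfa : MemLp (fun x => f (x + a)) 2 := hf.comp_measurePreserving hmp
  refine eLpNorm_le_of_forall_integral_mul_le (hfa.sub hf) hh.eLpNorm_ne_top fun φ hφ hφc => ?_
  have hφL : MemLp φ 2 := hφ.continuous.memLp_of_hasCompactSupport hφc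
  have hmpt : ∀ t : ℝ, MeasurePreserving (fun x : E3 => x - t • a) := fun t =>
    measurePreserving_sub_right volume (t • a)
  have hφt : ∀ t : ℝ, MemLp (fun x : E3 => φ (x - t • a)) 2 := fun t =>
    hφL.comp_measurePreserving (hmpt t)
  set F : ℝ → ℝ := fun t => ∫ x : E3, f x * φ (x - t • a)
  have hder : ∀ t, HasDerivAt F (∫ x : E3, h x * φ (x - t • a)) t := by
    intro t
    have h1 := hasDerivAt_integral_mul_translate (hf.locallyIntegrable (by simp)) hφ hφc a t
    have hcs : HasCompactSupport fun x : E3 => φ (x - t • a) := by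
      simpa [sub_eq_add_neg] using! hφc.comp_homeomorph (Homeomorph.addRight (-(t • a)))
    have h2 := hweak (fun x => φ (x - t • a)) (by fun_prop) hcs
    simp only [fderiv_comp_sub] at h2
    simp only [mul_neg, integral_neg, h2, neg_neg] at h1
    exact h1
  have hbound : ∀ t : ℝ, ‖∫ x : E3, h x * φ (x - t • a)‖ ≤
      (eLpNorm h 2).toReal * (eLpNorm φ 2).toReal := by
    intro t
    have h1 := abs_integral_mul_le_eLpNorm hh (hφt t)
    rwa [show eLpNorm (fun x : E3 => φ (x - t • a)) 2 volume =
      eLpNorm φ 2 volume from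
      eLpNorm_comp_measurePreserving hφL.aestronglyMeasurable (hmpt t)] at h1
  -- The difference `f(· + a) - f` paired with `φ` is `F 1 - F 0`, bounded by the mean value
  -- inequality.
  have hmv := Convex.norm_image_sub_le_of_norm_hasDerivWithin_le (f := F) (s := Set.univ)
    (fun t _ => (hder t).hasDerivWithinAt) (fun t _ => hbound t) convex_univ
    (Set.mem_univ 0) (Set.mem_univ 1)
  have h1 : ∫ x, f (x + a) * φ x = F 1 := by
    have := integral_add_right_eq_self (μ := (volume : Measure E3)) (fun x => f x * φ (x - a)) a
    simpa [F] using this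
  have h0 : ∫ x, f x * φ x = F 0 := by simp [F]
  have hsub : ∫ x, (f (x + a) - f x) * φ x = F 1 - F 0 := by
    rw [← h1, ← h0]
    refine Eq.trans ?_ (integral_sub (hfa.integrable_mul hφL) (hf.integrable_mul hφL))
    simp only [sub_mul]
  refine (congrArg abs hsub).trans_le ?_
  simpa using hmv

/-! ### Smooth cutoffs at a given distance from the complement -/

/-- Mollification of a compactly supported Lipschitz function. -/
lemma exists_contDiff_lipschitz_approx {d : E3 → ℝ} (hd : LipschitzWith 1 d)
    (hdc : HasCompactSupport d) {δ : ℝ} (hδ : 0 < δ) :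
    ∃ g : E3 → ℝ, ContDiff ℝ ∞ g ∧ LipschitzWith 1 g ∧ ∀ x, |g x - d x| ≤ δ := by
  let φ : ContDiffBump (0 : E3) := ⟨δ / 2, δ, half_pos hδ, half_lt_self hδ⟩
  have hdint : Integrable d := hd.continuous.integrable_of_hasCompactSupport hdc
  refine ⟨convolution (φ.normed volume) d (ContinuousLinearMap.lsmul ℝ ℝ) volume,
    φ.hasCompactSupport_normed.contDiff_convolution_left _ φ.contDiff_normed
      hdint.locallyIntegrable, ?_, ?_⟩
  · refine LipschitzWith.of_dist_le_mul fun x y => ?_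
    have hint : ∀ z : E3, Integrable fun t => φ.normed volume t * d (z - t) := fun z => by
      refine Continuous.integrable_of_hasCompactSupport ?_ φ.hasCompactSupport_normed.mul_right
      exact φ.continuous_normed.mul (hd.continuous.comp (by fun_prop))
    simp only [convolution, ContinuousLinearMap.lsmul_apply, smul_eq_mul, NNReal.coe_one, one_mul,
      Real.dist_eq]
    rw [← integral_sub (hint x) (hint y), ← Real.norm_eq_abs]
    calc _ ≤ ∫ t, φ.normed volume t * dist x y := by
          refine norm_integral_le_of_norm_le (φ.integrable_normed.mul_const _) (.of_forall ?_)
          intro t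
          rw [← mul_sub, norm_mul, Real.norm_of_nonneg (φ.nonneg_normed t)]
          gcongr
          · exact φ.nonneg_normed t
          · simpa [Real.dist_eq] using hd.dist_le_mul (x - t) (y - t)
      _ = dist x y := by rw [integral_mul_const, φ.integral_normed, one_mul]
  · intro x
    rw [← Real.dist_eq]
    refine φ.dist_normed_convolution_le hd.continuous.aestronglyMeasurable fun y hy => ?_
    refine (hd.dist_le_mul y x).trans ?_
    simpa using (Metric.mem_ball.1 hy).le

lemma exists_abs_deriv_smoothTransition_le :
    ∃ C, 0 ≤ C ∧ ∀ x, |deriv Real.smoothTransition x| ≤ C := by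
  have hc : Continuous (deriv Real.smoothTransition) :=
    (Real.smoothTransition.contDiff (n := 1)).continuous_deriv le_rfl
  obtain ⟨C, hC⟩ := (isCompact_Icc (a := (0 : ℝ)) (b := 1)).exists_bound_of_continuousOn
    hc.continuousOn
  refine ⟨max C 0, le_max_right _ _, fun x => ?_⟩
  by_cases hx : x ∈ Set.Icc (0 : ℝ) 1
  · exact (hC x hx).trans (le_max_left _ _)
  · suffices deriv Real.smoothTransition x = 0 by simp [this]
    rw [Set.mem_Icc, not_and_or, not_le, not_le] at hx
    rcases hx with hx | hx
    · have : Real.smoothTransition =ᶠ[𝓝 x] fun _ => 0 := by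
        filter_upwards [gt_mem_nhds hx] with y hy
        exact Real.smoothTransition.zero_of_nonpos hy.le
      rw [this.deriv_eq, deriv_const]
    · have : Real.smoothTransition =ᶠ[𝓝 x] fun _ => 1 := by
        filter_upwards [lt_mem_nhds hx] with y hy
        exact Real.smoothTransition.one_of_one_le hy.le
      rw [this.deriv_eq, deriv_const]

lemma nonempty_compl_of_isBounded {Ω : Set E3} (hb : Bornology.IsBounded Ω) : Ωᶜ.Nonempty := by
  rw [Set.nonempty_compl]
  rintro rfl
  exact NormedSpace.unbounded_univ ℝ E3 hb

/-- Smooth cutoffs at scale `δ` from the complement of a bounded open set. -/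
theorem exists_cutoff : ∃ C : ℝ, 0 ≤ C ∧ ∀ Ω : Set E3, IsOpen Ω → Bornology.IsBounded Ω →
    ∀ δ : ℝ, 0 < δ → ∃ η : E3 → ℝ, IsTestFunction Ω η ∧ (∀ x, 0 ≤ η x ∧ η x ≤ 1) ∧
      (∀ x, ‖fderiv ℝ η x‖ ≤ C / δ) ∧ (∀ x, 4 * δ ≤ Metric.infDist x Ωᶜ → η x = 1) ∧
      ∀ x, 4 * δ < Metric.infDist x Ωᶜ → fderiv ℝ η x = 0 := by
  obtain ⟨C, hC0, hC⟩ := exists_abs_deriv_smoothTransition_le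
  refine ⟨C, hC0, fun Ω hΩ hb δ hδ => ?_⟩
  set d : E3 → ℝ := fun x => Metric.infDist x Ωᶜ
  have hd : LipschitzWith 1 d := Metric.lipschitz_infDist_pt _
  have hd0 : ∀ x, x ∉ Ω → d x = 0 := fun x hx => Metric.infDist_zero_of_mem hx
  have hdc : HasCompactSupport d :=
    HasCompactSupport.of_support_subset_isCompact hb.isCompact_closure fun x hx =>
      subset_closure (by_contra fun h => hx (hd0 x h))
  obtain ⟨g, hg, hgL, hgd⟩ := exists_contDiff_lipschitz_approx hd hdc hδ
  -- Since `|g - d| ≤ δ`, the argument `g / δ - 2` is at least `1` where `d ≥ 4δ` and at most `0`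
  -- where `d < δ`.
  have h1 : ∀ x, 4 * δ ≤ d x → Real.smoothTransition (g x / δ - 2) = 1 := by
    intro x hx
    apply Real.smoothTransition.one_of_one_le
    have := (abs_le.1 (hgd x)).1
    rw [le_sub_iff_add_le, le_div_iff₀ hδ]
    linarith
  have hsub : tsupport (fun x => Real.smoothTransition (g x / δ - 2)) ⊆ {x | δ ≤ d x} := by
    refine closure_minimal (fun x hx => ?_) (isClosed_le continuous_const hd.continuous)
    by_contra hlt
    refine hx (Real.smoothTransition.zero_of_nonpos ?_)
    have := (abs_le.1 (hgd x)).2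
    rw [Set.mem_ofPred_eq, not_le] at hlt
    rw [sub_nonpos, div_le_iff₀ hδ]
    linarith
  have hsubΩ : {x | δ ≤ d x} ⊆ Ω := fun x hx => by
    by_contra h
    rw [Set.mem_ofPred_eq, hd0 x h] at hx
    linarith
  refine ⟨fun x => Real.smoothTransition (g x / δ - 2), ⟨?_, ?_, hsub.trans hsubΩ⟩,
    fun x => ⟨Real.smoothTransition.nonneg _, Real.smoothTransition.le_one _⟩, fun x => ?_, h1,
    fun x hx => ?_⟩
  · exact Real.smoothTransition.contDiff.comp ((hg.div_const δ).sub contDiff_const)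
  · exact (hb.subset (hsub.trans hsubΩ)).isCompact_closure.of_isClosed_subset
      (isClosed_tsupport _) subset_closure
  · have hgx := (hg.differentiable (by simp) x).hasFDerivAt
    have hst := ((Real.smoothTransition.contDiffAt (x := g x / δ - 2) (n := 1)).differentiableAt
      (by simp)).hasDerivAt
    have hin : HasFDerivAt (fun x => g x / δ - 2) (δ⁻¹ • fderiv ℝ g x) x := by
      simpa [div_eq_inv_mul] using (hgx.const_mul δ⁻¹).sub_const 2
    have hcomp := hst.comp_hasFDerivAt x hin
    rw [Function.comp_def] at hcomp
    rw [hcomp.fderiv, norm_smul, norm_smul, Real.norm_eq_abs,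
      Real.norm_of_nonneg (by positivity)]
    calc _ ≤ C * (δ⁻¹ * 1) := by
          gcongr
          · exact hC _
          · simpa using norm_fderiv_le_of_lipschitz ℝ hgL
      _ = C / δ := by rw [mul_one, div_eq_mul_inv]
  · have : (fun x => Real.smoothTransition (g x / δ - 2)) =ᶠ[𝓝 x] fun _ => 1 := by
      filter_upwards [hd.continuous.continuousAt.eventually (lt_mem_nhds hx)] with y hy
      exact h1 y hy.le
    rw [this.fderiv_eq, fderiv_const_apply]

/-! ### Smallness in boundary strips -/

/-- Near a boundary point, points close to the complement leave the domain when moved by a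
comparable distance in a fixed direction. -/
lemma exists_local_exit {Ω : Set E3} (hΩ : IsBoundedSmoothDomain Ω) {x₀ : E3}
    (hx₀ : x₀ ∈ frontier Ω) : ∃ (s : ℝ) (e : E3), 0 < s ∧
      ∀ δ, 0 < δ → δ < s → ∀ x ∈ Metric.ball x₀ s, Metric.infDist x Ωᶜ < δ → x + δ • e ∉ Ω := by
  obtain ⟨ρ, r, hr, hd, hc, hne, hiff⟩ := hΩ.exists_ball hx₀
  have hstrict : HasStrictFDerivAt ρ (fderiv ℝ ρ x₀) x₀ :=
    hasStrictFDerivAt_of_hasFDerivAt_of_continuousAt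
      (by filter_upwards [Metric.ball_mem_nhds x₀ hr] with x hx using (hd x hx).hasFDerivAt)
      (hc.continuousAt (Metric.ball_mem_nhds x₀ hr))
  -- Let `z ∉ Ω` be within `δ` of `x`. Passing from `z` to `x` lowers the linear part by at most
  -- `‖ρ'‖ δ`, so the step `δ e` leaves a net gain of at least `δ`; this absorbs the linearisation
  -- error, which is at most `δ`.
  obtain ⟨e, he⟩ : ∃ e, fderiv ℝ ρ x₀ e = ‖fderiv ℝ ρ x₀‖ + 1 := by
    obtain ⟨e, he⟩ : ∃ e, fderiv ℝ ρ x₀ e ≠ 0 := by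
      by_contra! h
      exact hne (ContinuousLinearMap.ext h)
    exact ⟨((‖fderiv ℝ ρ x₀‖ + 1) / fderiv ℝ ρ x₀ e) • e, by
      rw [map_smul, smul_eq_mul, div_mul_cancel₀ _ he]⟩
  have hε : (0 : ℝ) < 1 / (‖e‖ + 1) := by positivity
  obtain ⟨u, hu, hball⟩ := Metric.mem_nhds_iff.1 (hstrict.isLittleO.def hε)
  set m := min u r with hm
  have hm0 : 0 < m := lt_min hu hr
  -- The radius keeps both `z` and `x + δ e` within `m` of `x₀`.
  refine ⟨m / (‖e‖ + 2), e, by positivity, fun δ hδ hδs x hx hxd => ?_⟩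
  obtain ⟨z, hz, hxz⟩ := (Metric.infDist_lt_iff (nonempty_compl_of_isBounded hΩ.isBounded)).1 hxd
  have hmul : m / (‖e‖ + 2) * (‖e‖ + 2) = m := div_mul_cancel₀ _ (by positivity)
  set s := m / (‖e‖ + 2)
  rw [Metric.mem_ball] at hx
  have hs : 0 < s := by positivity
  have hse : 0 ≤ s * ‖e‖ := by positivity
  have hzm : dist z x₀ < m := by
    have := dist_triangle z x x₀
    rw [dist_comm z x] at this
    nlinarith
  have hδe : δ * ‖e‖ ≤ s * ‖e‖ := by gcongr
  have hym : dist (x + δ • e) x₀ < m := by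
    have h1 := dist_triangle (x + δ • e) x x₀
    have h2 : dist (x + δ • e) x = δ * ‖e‖ := by
      simp [dist_eq_norm, norm_smul, abs_of_pos hδ]
    nlinarith
  have hzr : z ∈ Metric.ball x₀ r := Metric.mem_ball.2 (hzm.trans_le (min_le_right _ _))
  have hyr : x + δ • e ∈ Metric.ball x₀ r := Metric.mem_ball.2 (hym.trans_le (min_le_right _ _))
  have hmem : (x + δ • e, z) ∈ Metric.ball (x₀, x₀) u := by
    rw [Metric.mem_ball, Prod.dist_eq]
    exact max_lt (hym.trans_le (min_le_left _ _)) (hzm.trans_le (min_le_left _ _))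
  have h1 := hball hmem
  simp only [Set.mem_ofPred_eq] at h1
  have hρz : 0 ≤ ρ z := not_lt.1 fun h => hz ((hiff z hzr).2 h)
  rw [hiff _ hyr, not_lt]
  have hdiff : x + δ • e - z = δ • e + (x - z) := by abel
  have hxz' : ‖x - z‖ ≤ δ := by rw [← dist_eq_norm]; exact hxz.le
  have h2 : ‖x + δ • e - z‖ ≤ δ * (‖e‖ + 1) := by
    rw [hdiff]
    refine (norm_add_le _ _).trans ?_
    rw [norm_smul, Real.norm_of_nonneg hδ.le]
    linarith
  have h3 : 1 / (‖e‖ + 1) * ‖x + δ • e - z‖ ≤ δ := by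
    rw [div_mul_eq_mul_div, one_mul, div_le_iff₀ (by positivity)]
    exact h2
  have h4 : δ ≤ fderiv ℝ ρ x₀ (x + δ • e - z) := by
    rw [hdiff, map_add, map_smul, he, smul_eq_mul]
    have h5 : |fderiv ℝ ρ x₀ (x - z)| ≤ ‖fderiv ℝ ρ x₀‖ * δ :=
      ((fderiv ℝ ρ x₀).le_opNorm _).trans (by gcongr)
    have := (abs_le.1 h5).1
    linarith
  have h6 := (abs_le.1 (h1.trans h3)).1
  linarith

/-- Points close to the complement leave the domain when moved by a comparable distance in one of
finitely many directions. -/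
theorem exists_finset_exit {Ω : Set E3} (hΩ : IsBoundedSmoothDomain Ω) :
    ∃ (t : Finset E3) (δ₀ : ℝ), 0 < δ₀ ∧ ∀ δ, 0 < δ → δ < δ₀ → ∀ x ∈ Ω,
      Metric.infDist x Ωᶜ < δ → ∃ e ∈ t, x + δ • e ∉ Ω := by
  classical
  choose! s e hs he using fun x (hx : x ∈ frontier Ω) => exists_local_exit hΩ hx
  have hfr : IsCompact (frontier Ω) :=
    hΩ.isBounded.isCompact_closure.of_isClosed_subset isClosed_frontier frontier_subset_closure
  obtain ⟨t, ht, hcover⟩ := hfr.elim_nhds_subcover (fun x => Metric.ball x (s x))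
    fun x hx => Metric.ball_mem_nhds x (hs x hx)
  have hO : IsOpen (⋃ x ∈ t, Metric.ball x (s x)) := isOpen_biUnion fun _ _ => Metric.isOpen_ball
  -- What the boundary balls miss is a compact subset of `Ω`, hence at positive distance from the
  -- complement.
  have hKc : IsCompact (closure Ω \ ⋃ x ∈ t, Metric.ball x (s x)) :=
    hΩ.isBounded.isCompact_closure.diff hO
  obtain ⟨δ₁, hδ₁, hthick⟩ := hKc.exists_thickening_subset_open hΩ.isOpen (by
    rintro x ⟨hx, hxn⟩
    by_contra h
    exact hxn (hcover (hΩ.isOpen.frontier_eq ▸ ⟨hx, h⟩)))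
  obtain ⟨δ₂, hδ₂, hmin⟩ : ∃ δ₂ > 0, ∀ x ∈ t, δ₂ ≤ s x := by
    rcases t.eq_empty_or_nonempty with rfl | hne
    · exact ⟨1, one_pos, by simp⟩
    · obtain ⟨x, hx, hmin⟩ := t.exists_min_image s hne
      exact ⟨s x, hs x (ht x hx), hmin⟩
  refine ⟨t.image e, min δ₁ δ₂, lt_min hδ₁ hδ₂, fun δ hδ hδ' x hx hxd => ?_⟩
  by_cases hxU : x ∈ ⋃ x ∈ t, Metric.ball x (s x)
  · obtain ⟨y, hy, hxy⟩ := Set.mem_iUnion₂.1 hxU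
    exact ⟨e y, Finset.mem_image_of_mem e hy, he y (ht y hy) δ hδ
      ((hδ'.trans_le (min_le_right _ _)).trans_le (hmin y hy)) x hxy hxd⟩
  · exfalso
    obtain ⟨z, hz, hxz⟩ := (Metric.infDist_lt_iff (nonempty_compl_of_isBounded hΩ.isBounded)).1 hxd
    refine hz (hthick (Metric.mem_thickening_iff.2 ⟨x, ⟨subset_closure hx, hxU⟩, ?_⟩))
    rw [dist_comm]
    exact hxz.trans (hδ'.trans_le (min_le_left _ _))

/-- An `H¹` function on the whole space vanishing outside `Ω` is small in `L²` near the boundary. -/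
theorem exists_eLpNorm_strip_le {Ω : Set E3} (hΩ : IsBoundedSmoothDomain Ω) {f : E3 → ℝ}
    {h : E3 → E3} (hf : MemLp f 2) (hh : MemLp h 2) (hf0 : ∀ x, x ∉ Ω → f x = 0)
    (hweak : ∀ (a : E3) (φ : E3 → ℝ), ContDiff ℝ ∞ φ → HasCompactSupport φ →
      ∫ x, f x * fderiv ℝ φ x a = -∫ x, inner ℝ (h x) a * φ x) :
    ∃ (C : ENNReal) (δ₀ : ℝ), C ≠ ⊤ ∧ 0 < δ₀ ∧ ∀ δ, 0 < δ → δ < δ₀ →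
      eLpNorm f 2 (volume.restrict (Ω ∩ {x | Metric.infDist x Ωᶜ < δ})) ≤
        C * ENNReal.ofReal δ := by
  obtain ⟨t, δ₀, hδ₀, ht⟩ := exists_finset_exit hΩ
  have hhe : ∀ e : E3, MemLp (fun x => inner ℝ (h x) e) 2 := fun e => hh.inner_const e
  have hC : ∑ e ∈ t, eLpNorm (fun x => inner ℝ (h x) e) 2 volume ≠ ⊤ :=
    ENNReal.sum_ne_top.2 fun e _ => (hhe e).eLpNorm_ne_top
  refine ⟨∑ e ∈ t, eLpNorm (fun x => inner ℝ (h x) e) 2 volume, δ₀, hC, hδ₀, fun δ hδ hδδ => ?_⟩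
  have hmeas : MeasurableSet (Ω ∩ {x | Metric.infDist x Ωᶜ < δ}) :=
    hΩ.isOpen.measurableSet.inter
      (isOpen_lt (Metric.continuous_infDist_pt _) continuous_const).measurableSet
  have htr : ∀ e : E3, eLpNorm (fun x => f (x + δ • e) - f x) 2 ≤
      eLpNorm (fun x => inner ℝ (h x) e) 2 * ENNReal.ofReal δ := by
    intro e
    have h1 := eLpNorm_translate_sub_le (a := δ • e) hf (hhe (δ • e)) (hweak (δ • e))
    refine h1.trans_eq ?_
    have : (fun x => inner ℝ (h x) (δ • e)) = δ • fun x => inner ℝ (h x) e := by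
      funext x; simp [inner_smul_right]
    rw [this, eLpNorm_const_smul, mul_comm, Real.enorm_eq_ofReal hδ.le]
  set G : E3 → E3 → ℝ := fun e x => ‖f (x + δ • e) - f x‖ with hG
  have hm : ∀ e, AEStronglyMeasurable (G e) volume := fun e =>
    ((hf.comp_measurePreserving (measurePreserving_add_right volume (δ • e))).sub
      hf).aestronglyMeasurable.norm
  have hG0 : ∀ e x, 0 ≤ G e x := fun e x => norm_nonneg _
  -- On the strip some translate `x + δ e` leaves `Ω`, where `f` vanishes, so `|f x|` is itself one
  -- of the differences.
  have hpt : ∀ x, ‖(Ω ∩ {x | Metric.infDist x Ωᶜ < δ}).indicator f x‖ ≤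
      ‖(∑ e ∈ t, G e) x‖ := by
    intro x
    rw [Finset.sum_apply, Real.norm_of_nonneg (Finset.sum_nonneg fun e _ => hG0 e x)]
    by_cases hx : x ∈ Ω ∩ {x | Metric.infDist x Ωᶜ < δ}
    · obtain ⟨e, he, hxe⟩ := ht δ hδ hδδ x hx.1 hx.2
      rw [Set.indicator_of_mem hx]
      refine le_trans ?_ (Finset.single_le_sum (f := fun e => G e x) (fun e _ => hG0 e x) he)
      simp [hG, hf0 _ hxe]
    · rw [Set.indicator_of_notMem hx, norm_zero]
      exact Finset.sum_nonneg fun e _ => hG0 e x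
  rw [← eLpNorm_indicator_eq_eLpNorm_restrict hmeas, Finset.sum_mul]
  refine (eLpNorm_mono hpt).trans ((eLpNorm_sum_le (fun e _ => hm e) (by norm_num)).trans ?_)
  refine Finset.sum_le_sum fun e _ => ?_
  rw [eLpNorm_norm]
  exact htr e

/-! ### Gradients, limits of products and the flat truncation -/

lemma inner_grad (f : E3 → ℝ) (x a : E3) : inner ℝ (grad f x) a = fderiv ℝ f x a := by
  have ha : a = ∑ i, a i • EuclideanSpace.single i (1 : ℝ) := by
    ext j
    simp [Finset.sum_apply, Pi.single_apply]
  conv_rhs => rw [ha]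
  simp [Fin.sum_univ_three, grad, partialDeriv, PiLp.inner_apply]

lemma continuous_grad {f : E3 → ℝ} (hf : ContDiff ℝ 1 f) : Continuous (grad f) := by
  have : ∀ i, Continuous (partialDeriv i f) := fun i =>
    (hf.continuous_fderiv (by simp)).clm_apply continuous_const
  rw [show grad f = fun x => WithLp.toLp 2 ![partialDeriv 0 f x, partialDeriv 1 f x,
    partialDeriv 2 f x] from rfl]
  refine (PiLp.continuous_toLp 2 _).comp (continuous_pi fun i => ?_)
  fin_cases i
  · exact this 0
  · exact this 1
  · exact this 2

lemma integrable_inner_of_memLp {α : Type*} [MeasurableSpace α] {μ : Measure α} {f g : α → E3}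
    (hf : MemLp f 2 μ) (hg : MemLp g 2 μ) : Integrable (fun x => inner ℝ (f x) (g x)) μ := by
  refine (hf.norm.integrable_mul hg.norm).mono'
    (hf.aestronglyMeasurable.inner hg.aestronglyMeasurable) (.of_forall fun x => ?_)
  exact norm_inner_le_norm _ _

/-- Limits of integrals of products: bounded a.e. convergence times `L²` convergence. -/
lemma tendsto_integral_mul_inner {α : Type*} [MeasurableSpace α] {μ : Measure α}
    {m : ℕ → α → ℝ} {m₀ : α → ℝ} {w : ℕ → α → E3} {w₀ θ : α → E3} {M : ℝ}
    (hm : ∀ n, AEStronglyMeasurable (m n) μ)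
    (hbound : ∀ n x, ‖m n x‖ ≤ M)
    (hlim : ∀ᵐ x ∂μ, Tendsto (fun n => m n x) atTop (𝓝 (m₀ x)))
    (hw : ∀ n, AEStronglyMeasurable (w n) μ) (hw₀ : MemLp w₀ 2 μ) (hθ : MemLp θ 2 μ)
    (hww : Tendsto (fun n => eLpNorm (fun x => w n x - w₀ x) 2 μ) atTop (𝓝 0)) :
    Tendsto (fun n => ∫ x, m n x * inner ℝ (w n x) (θ x) ∂μ) atTop
      (𝓝 (∫ x, m₀ x * inner ℝ (w₀ x) (θ x) ∂μ)) := by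
  have hbdd : ∀ n (F : α → ℝ), Integrable F μ → Integrable (fun x => m n x * F x) μ :=
    fun n F hF => hF.bdd_mul (hm n) (.of_forall (hbound n))
  have h1 : Tendsto (fun n => ∫ x, m n x * inner ℝ (w₀ x) (θ x) ∂μ) atTop
      (𝓝 (∫ x, m₀ x * inner ℝ (w₀ x) (θ x) ∂μ)) := by
    have hi := integrable_inner_of_memLp hw₀ hθ
    refine tendsto_integral_of_dominated_convergence (fun x => M * ‖inner ℝ (w₀ x) (θ x)‖)
      (fun n => (hm n).mul hi.aestronglyMeasurable) (hi.norm.const_mul M) (fun n => ?_) ?_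
    · refine .of_forall fun x => ?_
      rw [norm_mul]
      gcongr
      exact hbound n x
    · filter_upwards [hlim] with x hx using hx.mul_const _
  have hfin : ∀ᶠ n in atTop, eLpNorm (fun x => w n x - w₀ x) 2 μ < ⊤ :=
    hww.eventually (gt_mem_nhds ENNReal.zero_lt_top)
  have h2 : Tendsto (fun n => ∫ x, m n x * inner ℝ (w n x - w₀ x) (θ x) ∂μ) atTop (𝓝 0) := by
    have hreal : Tendsto (fun n => M * ((eLpNorm (fun x => w n x - w₀ x) 2 μ).toReal *
        (eLpNorm θ 2 μ).toReal)) atTop (𝓝 0) := by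
      have := ((ENNReal.tendsto_toReal ENNReal.zero_ne_top).comp hww).mul_const
        (eLpNorm θ 2 μ).toReal |>.const_mul M
      simpa using this
    refine squeeze_zero_norm' ?_ hreal
    filter_upwards [hfin] with n hn
    have hL : MemLp (fun x => w n x - w₀ x) 2 μ := ⟨(hw n).sub hw₀.aestronglyMeasurable, hn⟩
    have hcs := abs_integral_mul_le_eLpNorm hL.norm hθ.norm
    rw [eLpNorm_norm, eLpNorm_norm] at hcs
    have hprod : Integrable (fun x => ‖w n x - w₀ x‖ * ‖θ x‖) μ := hL.norm.integrable_mul hθ.norm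
    calc _ ≤ ∫ x, M * (‖w n x - w₀ x‖ * ‖θ x‖) ∂μ := by
          refine norm_integral_le_of_norm_le (hprod.const_mul M) (.of_forall fun x => ?_)
          rw [norm_mul]
          exact mul_le_mul (hbound n x) (norm_inner_le_norm _ _) (norm_nonneg _)
            ((norm_nonneg _).trans (hbound n x))
      _ = M * ∫ x, ‖w n x - w₀ x‖ * ‖θ x‖ ∂μ := integral_const_mul _ _
      _ ≤ _ := by
          rcases isEmpty_or_nonempty α with hα | ⟨⟨x⟩⟩
          · simp [Measure.eq_zero_of_isEmpty μ]
          · have : 0 ≤ M := (norm_nonneg _).trans (hbound n x)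
            gcongr
            exact (le_abs_self _).trans hcs
  have h3 := h2.add h1
  rw [zero_add] at h3
  refine h3.congr' ?_
  filter_upwards [hfin] with n hn
  have hL : MemLp (fun x => w n x - w₀ x) 2 μ := ⟨(hw n).sub hw₀.aestronglyMeasurable, hn⟩
  rw [← integral_add (hbdd n _ (integrable_inner_of_memLp hL hθ))
    (hbdd n _ (integrable_inner_of_memLp hw₀ hθ))]
  simp only [← mul_add, ← inner_add_left, sub_add_cancel]

/-- The derivative of the flat truncation `expNegInvGlue`. -/
noncomputable def glueDeriv (t : ℝ) : ℝ := t⁻¹ ^ 2 * expNegInvGlue t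

lemma hasDerivAt_expNegInvGlue (t : ℝ) : HasDerivAt expNegInvGlue (glueDeriv t) t := by
  simpa [glueDeriv] using expNegInvGlue.hasDerivAt_polynomial_eval_inv_mul 1 t

lemma continuous_glueDeriv : Continuous glueDeriv := by
  have := expNegInvGlue.continuous_polynomial_eval_inv_mul (Polynomial.X ^ 2)
  simp only [Polynomial.eval_pow, Polynomial.eval_X] at this
  exact this

lemma expNegInvGlue_le_one (t : ℝ) : expNegInvGlue t ≤ 1 := by
  unfold expNegInvGlue
  split_ifs with h
  · exact zero_le_one
  · rw [Real.exp_le_one_iff, neg_nonpos, inv_nonneg]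
    exact (not_le.1 h).le

lemma glueDeriv_nonneg (t : ℝ) : 0 ≤ glueDeriv t :=
  mul_nonneg (sq_nonneg _) (expNegInvGlue.nonneg t)

/-- With `r = 1/t`, the bound is `r² ≤ 2 exp r`, from the quadratic Taylor bound of the exponential.
-/
lemma glueDeriv_le_two (t : ℝ) : glueDeriv t ≤ 2 := by
  rcases le_or_gt t 0 with h | h
  · simp [glueDeriv, expNegInvGlue.zero_of_nonpos h]
  · have h1 := Real.quadratic_le_exp_of_nonneg (inv_nonneg.2 h.le)
    have h2 : 0 < t⁻¹ := inv_pos.2 h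
    rw [glueDeriv, expNegInvGlue, if_neg h.not_ge, Real.exp_neg, ← div_eq_mul_inv,
      div_le_iff₀ (Real.exp_pos _)]
    nlinarith

/-- Quadratic smallness turns `L²` convergence of traces into `L¹` convergence of truncations. It is
used with `t = vₙ - s` and `r = vₙ - γ`, where `γ ≤ s`. -/
lemma expNegInvGlue_le_sq {t r : ℝ} (hr : t ≤ r) : expNegInvGlue t ≤ 2 * r ^ 2 := by
  rcases le_or_gt t 0 with h | h
  · rw [expNegInvGlue.zero_of_nonpos h]; positivity
  · have h1 := glueDeriv_le_two t
    rw [glueDeriv, inv_pow, inv_mul_le_iff₀ (by positivity)] at h1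
    nlinarith

lemma memLp_restrict_of_continuous {F : Type*} [NormedAddCommGroup F] [SecondCountableTopology F]
    {Ω : Set E3} (hb : Bornology.IsBounded Ω) {f : E3 → F} (hf : Continuous f) :
    MemLp f 2 (volume.restrict Ω) := by
  have hK := hb.isCompact_closure
  obtain ⟨C, hC⟩ := hK.exists_bound_of_continuousOn hf.continuousOn
  have : IsFiniteMeasure (volume.restrict (closure Ω)) := ⟨by simpa using hK.measure_lt_top⟩
  refine MemLp.mono_measure (Measure.restrict_mono subset_closure le_rfl)
    (MemLp.of_bound hf.aestronglyMeasurable C ?_)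
  exact (ae_restrict_mem isClosed_closure.measurableSet).mono hC

/-! ### Truncations and the weak maximum principle -/

/-- Smooth functions `vₙ` approximating `u` in `H¹(Ω)`, with gradients converging to `g`. -/
structure H1Approx (Ω : Set E3) (u : E3 → ℝ) (g : E3 → E3) (v : ℕ → E3 → ℝ) : Prop where
  memLp : MemLp u 2 (volume.restrict Ω)
  memLp_grad : MemLp g 2 (volume.restrict Ω)
  smooth : ∀ n, ContDiff ℝ ∞ (v n)
  tendsto : Tendsto (fun n => eLpNorm (fun x => v n x - u x) 2 (volume.restrict Ω)) atTop (𝓝 0)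
  tendsto_grad :
    Tendsto (fun n => eLpNorm (fun x => grad (v n) x - g x) 2 (volume.restrict Ω)) atTop (𝓝 0)

/-- Pointwise convergence is needed to pass to the limit inside the nonlinear truncation. -/
lemma H1Approx.exists_subseq {Ω : Set E3} {u : E3 → ℝ} {g : E3 → E3} {v : ℕ → E3 → ℝ}
    (H : H1Approx Ω u g v) : ∃ ns : ℕ → ℕ, Tendsto ns atTop atTop ∧
      H1Approx Ω u g (fun n => v (ns n)) ∧
      ∀ᵐ x ∂volume.restrict Ω, Tendsto (fun n => v (ns n) x) atTop (𝓝 (u x)) := by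
  have h := tendstoInMeasure_of_tendsto_eLpNorm (p := 2) (μ := volume.restrict Ω) (f := v)
    (by norm_num) (fun n => (H.smooth n).continuous.aestronglyMeasurable)
    H.memLp.aestronglyMeasurable H.tendsto
  obtain ⟨ns, hns, hae⟩ := h.exists_seq_tendsto_ae
  exact ⟨ns, hns.tendsto_atTop, ⟨H.memLp, H.memLp_grad, fun n => H.smooth _,
    H.tendsto.comp hns.tendsto_atTop, H.tendsto_grad.comp hns.tendsto_atTop⟩, hae⟩

lemma contDiff_truncation {v : E3 → ℝ} (hv : ContDiff ℝ ∞ v) (s : ℝ) :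
    ContDiff ℝ ∞ (fun y => expNegInvGlue (v y - s)) :=
  expNegInvGlue.contDiff.comp (hv.sub contDiff_const)

lemma fderiv_truncation_mul {v φ : E3 → ℝ} (hv : ContDiff ℝ ∞ v) (hφ : ContDiff ℝ ∞ φ) (s : ℝ)
    (x b : E3) : fderiv ℝ (fun y => expNegInvGlue (v y - s) * φ y) x b =
      glueDeriv (v x - s) * inner ℝ (grad v x) (φ x • b) +
        expNegInvGlue (v x - s) * inner ℝ (grad φ x) b := by
  have h1 : HasFDerivAt (fun y => v y - s) (fderiv ℝ v x) x :=
    (hv.differentiable (by simp) x).hasFDerivAt.sub_const s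
  have h2 := (hasDerivAt_expNegInvGlue (v x - s)).comp_hasFDerivAt x h1
  rw [Function.comp_def] at h2
  rw [(h2.fun_mul (hφ.differentiable (by simp) x).hasFDerivAt).fderiv]
  simp only [add_apply, smul_apply, smul_eq_mul,
    inner_smul_right, inner_grad]
  ring

lemma norm_glueDeriv_le (t : ℝ) : ‖glueDeriv t‖ ≤ 2 := by
  rw [Real.norm_of_nonneg (glueDeriv_nonneg t)]
  exact glueDeriv_le_two t

lemma norm_expNegInvGlue_le (t : ℝ) : ‖expNegInvGlue t‖ ≤ 1 := by
  rw [Real.norm_of_nonneg (expNegInvGlue.nonneg t)]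
  exact expNegInvGlue_le_one t

lemma continuous_expNegInvGlue : Continuous expNegInvGlue :=
  (expNegInvGlue.contDiff (n := 0)).continuous

lemma memLp_smul_of_compactSupport {Ω : Set E3} {φ : E3 → ℝ} {b : E3 → E3} (hφ : Continuous φ)
    (hφc : HasCompactSupport φ) (hb : MemLp b 2 (volume.restrict Ω)) :
    MemLp (fun x => φ x • b x) 2 (volume.restrict Ω) := by
  obtain ⟨C, hC⟩ := hφ.bounded_above_of_compact_support hφc
  refine hb.of_le_mul (c := C) (hφ.aestronglyMeasurable.smul hb.aestronglyMeasurable)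
    (.of_forall fun x => ?_)
  rw [norm_smul]
  gcongr
  exact hC x

/-- The direction is an `L²` field `b` because two cases are needed: a constant, for the weak
gradient of the zero extension, and `b = g`, for testing harmonicity. -/
lemma H1Approx.tendsto_setIntegral_truncation {Ω : Set E3} (hΩb : Bornology.IsBounded Ω)
    {u : E3 → ℝ} {g : E3 → E3} {v : ℕ → E3 → ℝ} (H : H1Approx Ω u g v)
    (hae : ∀ᵐ x ∂volume.restrict Ω, Tendsto (fun n => v n x) atTop (𝓝 (u x))) (s : ℝ)
    {φ : E3 → ℝ} (hφ : ContDiff ℝ ∞ φ) (hφc : HasCompactSupport φ) {b : E3 → E3}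
    (hb : MemLp b 2 (volume.restrict Ω)) :
    Tendsto (fun n => ∫ x in Ω, fderiv ℝ (fun y => expNegInvGlue (v n y - s) * φ y) x (b x)) atTop
      (𝓝 ((∫ x in Ω, glueDeriv (u x - s) * inner ℝ (g x) (φ x • b x)) +
        ∫ x in Ω, expNegInvGlue (u x - s) * inner ℝ (grad φ x) (b x))) := by
  have hφb := memLp_smul_of_compactSupport hφ.continuous hφc hb
  have hgφ : MemLp (grad φ) 2 (volume.restrict Ω) :=
    memLp_restrict_of_continuous hΩb (continuous_grad (hφ.of_le (by simp)))
  have hgv : ∀ n, MemLp (grad (v n)) 2 (volume.restrict Ω) := fun n =>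
    memLp_restrict_of_continuous hΩb (continuous_grad ((H.smooth n).of_le (by simp)))
  have hvc : ∀ n, Continuous fun x => v n x - s := fun n => (H.smooth n).continuous.sub continuous_const
  have hm1 : ∀ n, AEStronglyMeasurable (fun x => glueDeriv (v n x - s)) (volume.restrict Ω) :=
    fun n => (continuous_glueDeriv.comp (hvc n)).aestronglyMeasurable
  have hm2 : ∀ n, AEStronglyMeasurable (fun x => expNegInvGlue (v n x - s))
      (volume.restrict Ω) := fun n => (continuous_expNegInvGlue.comp (hvc n)).aestronglyMeasurable
  have h1 := tendsto_integral_mul_inner (m := fun n x => glueDeriv (v n x - s))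
    (m₀ := fun x => glueDeriv (u x - s)) hm1 (fun n x => norm_glueDeriv_le _)
    (by
      filter_upwards [hae] with x hx
      exact (continuous_glueDeriv.tendsto _).comp (hx.sub_const s))
    (fun n => (hgv n).aestronglyMeasurable) H.memLp_grad hφb H.tendsto_grad
  have h2 := tendsto_integral_mul_inner (m := fun n x => expNegInvGlue (v n x - s))
    (m₀ := fun x => expNegInvGlue (u x - s)) (w := fun _ => grad φ) hm2
    (fun n x => norm_expNegInvGlue_le _)
    (by
      filter_upwards [hae] with x hx
      exact (continuous_expNegInvGlue.tendsto _).comp (hx.sub_const s))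
    (fun n => hgφ.aestronglyMeasurable) hgφ hb (by simp)
  refine (h1.add h2).congr fun n => ?_
  rw [← integral_add]
  · simp only [fderiv_truncation_mul (H.smooth n) hφ]
  · exact (integrable_inner_of_memLp (hgv n) hφb).bdd_mul (hm1 n)
      (.of_forall fun x => norm_glueDeriv_le _)
  · exact (integrable_inner_of_memLp hgφ hb).bdd_mul (hm2 n)
      (.of_forall fun x => norm_expNegInvGlue_le _)

lemma tendsto_lintegral_truncation {σ : Measure E3} {v : ℕ → E3 → ℝ} {γ : E3 → ℝ} {s : ℝ}
    (hγ : ∀ᵐ x ∂σ, γ x ≤ s)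
    (hv : Tendsto (fun n => eLpNorm (fun x => v n x - γ x) 2 σ) atTop (𝓝 0)) :
    Tendsto (fun n => ∫⁻ x, ‖expNegInvGlue (v n x - s)‖ₑ ∂σ) atTop (𝓝 0) := by
  have h1 : Tendsto (fun n => 2 * eLpNorm (fun x => v n x - γ x) 2 σ ^ 2) atTop (𝓝 0) := by
    have := ENNReal.Tendsto.const_mul (a := 2) (ENNReal.Tendsto.pow (n := 2) hv)
      (Or.inr (by simp))
    simpa using this
  refine tendsto_of_tendsto_of_tendsto_of_le_of_le tendsto_const_nhds h1 (fun _ => zero_le)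
    fun n => ?_
  have h2 : eLpNorm (fun x => v n x - γ x) 2 σ ^ 2 = ∫⁻ x, ‖v n x - γ x‖ₑ ^ 2 ∂σ := by
    have := eLpNorm_nnreal_pow_eq_lintegral (f := fun x => v n x - γ x) (μ := σ) (p := 2)
      (by norm_num)
    simpa using this
  simp only [h2]
  rw [← lintegral_const_mul' _ _ (by simp)]
  refine lintegral_mono_ae ?_
  filter_upwards [hγ] with x hx
  rw [Real.enorm_eq_ofReal (expNegInvGlue.nonneg _), ← enorm_pow, Real.enorm_eq_ofReal (sq_nonneg _),
    show (2 : ENNReal) = ENNReal.ofReal 2 by simp, ← ENNReal.ofReal_mul (by norm_num)]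
  exact ENNReal.ofReal_le_ofReal (expNegInvGlue_le_sq (by linarith))

/-- The truncation of a function whose trace is at most `s`, extended by zero, has a weak gradient
on the whole space. -/
lemma H1Approx.setIntegral_truncation_add_eq_zero {Ω : Set E3} (hΩ : IsBoundedSmoothDomain Ω)
    {u : E3 → ℝ} {g : E3 → E3} {v : ℕ → E3 → ℝ} (H : H1Approx Ω u g v)
    (hae : ∀ᵐ x ∂volume.restrict Ω, Tendsto (fun n => v n x) atTop (𝓝 (u x))) {s : ℝ}
    {γ : E3 → ℝ} (hγ : ∀ᵐ x ∂surfaceMeasure Ω, γ x ≤ s)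
    (hvγ : Tendsto (fun n => eLpNorm (fun x => v n x - γ x) 2 (surfaceMeasure Ω)) atTop (𝓝 0))
    {φ : E3 → ℝ} (hφ : ContDiff ℝ ∞ φ) (hφc : HasCompactSupport φ) (a : E3) :
    (∫ x in Ω, glueDeriv (u x - s) * inner ℝ (g x) (φ x • a)) +
        ∫ x in Ω, expNegInvGlue (u x - s) * inner ℝ (grad φ x) a = 0 := by
  have hlim := H.tendsto_setIntegral_truncation hΩ.isBounded hae s hφ hφc (b := fun _ => a)
    (memLp_restrict_of_continuous hΩ.isBounded continuous_const)
  refine tendsto_nhds_unique hlim ?_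
  -- The integrals whose limit was just identified are bounded by surface integrals of the
  -- truncations, which tend to zero.
  obtain ⟨C, hC⟩ := exists_enorm_setIntegral_fderiv_le hΩ a
  obtain ⟨M, hM⟩ := hφ.continuous.bounded_above_of_compact_support hφc
  have h0 : Tendsto (fun n => C * (ENNReal.ofReal M *
      ∫⁻ x, ‖expNegInvGlue (v n x - s)‖ₑ ∂surfaceMeasure Ω)) atTop (𝓝 0) := by
    have := ENNReal.Tendsto.const_mul (a := (C : ENNReal))
      (ENNReal.Tendsto.const_mul (a := ENNReal.ofReal M)
        (tendsto_lintegral_truncation hγ hvγ) (Or.inr (by simp))) (Or.inr (by simp))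
    simpa using this
  rw [tendsto_zero_iff_enorm_tendsto_zero]
  refine tendsto_of_tendsto_of_tendsto_of_le_of_le tendsto_const_nhds h0 (fun _ => zero_le)
    fun n => ?_
  refine (hC _ (((contDiff_truncation (H.smooth n) s).mul hφ).of_le (by simp))).trans ?_
  gcongr
  rw [← lintegral_const_mul' _ _ (by simp)]
  gcongr with x
  rw [enorm_mul, mul_comm]
  gcongr
  rw [← ofReal_norm]
  exact ENNReal.ofReal_le_ofReal (hM x)

/-- The strips shrink to the empty set because points of an open set have positive distance to its
complement; absolute continuity of the integral does the rest. -/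
lemma tendsto_eLpNorm_strip {Ω : Set E3} (hΩ : IsOpen Ω) (hb : Bornology.IsBounded Ω)
    {g : E3 → E3} (hg : MemLp g 2 (volume.restrict Ω)) {δ : ℕ → ℝ} (hδ : Antitone δ)
    (hδ0 : Tendsto δ atTop (𝓝 0)) :
    Tendsto (fun k => eLpNorm g 2 (volume.restrict (Ω ∩ {x | Metric.infDist x Ωᶜ < δ k}))) atTop
      (𝓝 0) := by
  set S : ℕ → Set E3 := fun k => {x | Metric.infDist x Ωᶜ < δ k}
  have hSo : ∀ k, IsOpen (S k) := fun k =>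
    isOpen_lt (Metric.continuous_infDist_pt _) continuous_const
  have : IsFiniteMeasure (volume.restrict Ω) := ⟨by simpa using hb.measure_lt_top⟩
  have hmeas : Tendsto (fun k => volume.restrict Ω (S k)) atTop (𝓝 0) := by
    have h := tendsto_measure_iInter_atTop (μ := volume.restrict Ω) (s := S)
      (fun k => (hSo k).measurableSet.nullMeasurableSet)
      (fun i j hij x hx => lt_of_lt_of_le hx (hδ hij)) ⟨0, measure_ne_top _ _⟩
    have h0 : volume.restrict Ω (⋂ k, S k) = 0 := by
      rw [Measure.restrict_apply (MeasurableSet.iInter fun k => (hSo k).measurableSet)]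
      convert measure_empty (μ := (volume : Measure E3))
      rw [Set.eq_empty_iff_forall_notMem]
      rintro x ⟨hx, hxΩ⟩
      have hpos : 0 < Metric.infDist x Ωᶜ :=
        (hΩ.isClosed_compl.notMem_iff_infDist_pos (nonempty_compl_of_isBounded hb)).1
          (fun h => h hxΩ)
      obtain ⟨k, hk⟩ := (hδ0.eventually (gt_mem_nhds hpos)).exists
      exact (lt_asymm hk) (Set.mem_iInter.1 hx k)
    rwa [h0] at h
  have hfin : ∫⁻ x in Ω, ‖g x‖ₑ ^ 2 ≠ ⊤ := by
    have h1 := eLpNorm_nnreal_pow_eq_lintegral (f := g) (μ := volume.restrict Ω) (p := 2)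
      (by norm_num)
    have h2 : eLpNorm g 2 (volume.restrict Ω) ^ 2 = ∫⁻ x in Ω, ‖g x‖ₑ ^ 2 := by simpa using h1
    rw [← h2]
    exact ENNReal.pow_ne_top hg.eLpNorm_ne_top
  have hlim := tendsto_setLIntegral_zero hfin hmeas
  have hsq : ∀ k, eLpNorm g 2 (volume.restrict (Ω ∩ S k)) =
      (∫⁻ x in S k, ‖g x‖ₑ ^ 2 ∂volume.restrict Ω) ^ (1 / 2 : ℝ) := by
    intro k
    rw [Measure.restrict_restrict (hSo k).measurableSet, Set.inter_comm,
      eLpNorm_eq_lintegral_rpow_enorm_toReal (by norm_num) (by norm_num)]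
    simp
  simp only [S] at hsq
  simp only [hsq]
  have := ((ENNReal.continuous_rpow_const (y := (1 / 2 : ℝ))).tendsto 0).comp hlim
  simpa [Function.comp_def] using this

/-- Weak maximum principle: a weakly harmonic function whose trace is at most `s` is at most `s`. -/
theorem H1Approx.ae_le_of_trace_le {Ω : Set E3} (hΩ : IsBoundedSmoothDomain Ω)
    {u : E3 → ℝ} {g : E3 → E3} {v : ℕ → E3 → ℝ} (H : H1Approx Ω u g v)
    (hharm : ∀ φ : E3 → ℝ, IsTestFunction Ω φ → ∫ x in Ω, fderiv ℝ φ x (g x) = 0) {s : ℝ}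
    {γ : E3 → ℝ} (hγ : ∀ᵐ x ∂surfaceMeasure Ω, γ x ≤ s)
    (hvγ : Tendsto (fun n => eLpNorm (fun x => v n x - γ x) 2 (surfaceMeasure Ω)) atTop (𝓝 0)) :
    ∀ᵐ x ∂volume.restrict Ω, u x ≤ s := by
  obtain ⟨ns, hns, H', hae⟩ := H.exists_subseq
  have hvγ' := hvγ.comp hns
  have hΩm := hΩ.isOpen.measurableSet
  have hfinm : IsFiniteMeasure (volume.restrict Ω) := ⟨by simpa using hΩ.isBounded.measure_lt_top⟩
  have hg := H.memLp_grad
  have hus : AEStronglyMeasurable (fun x => u x - s) (volume.restrict Ω) :=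
    H.memLp.aestronglyMeasurable.sub aestronglyMeasurable_const
  have hψm : AEStronglyMeasurable (fun x => expNegInvGlue (u x - s)) (volume.restrict Ω) :=
    continuous_expNegInvGlue.comp_aestronglyMeasurable hus
  have hψm' : AEStronglyMeasurable (fun x => glueDeriv (u x - s)) (volume.restrict Ω) :=
    continuous_glueDeriv.comp_aestronglyMeasurable hus
  set f : E3 → ℝ := Ω.indicator fun x => expNegInvGlue (u x - s) with hfdef
  set h : E3 → E3 := Ω.indicator fun x => glueDeriv (u x - s) • g x with hhdef
  have hf : MemLp f 2 := by
    rw [hfdef, memLp_indicator_iff_restrict hΩm]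
    exact MemLp.of_bound hψm 1 (.of_forall fun x => norm_expNegInvGlue_le _)
  have hh : MemLp h 2 := by
    rw [hhdef, memLp_indicator_iff_restrict hΩm]
    refine hg.of_le_mul (c := 2) (hψm'.smul hg.aestronglyMeasurable) (.of_forall fun x => ?_)
    rw [norm_smul]
    gcongr
    exact norm_glueDeriv_le _
  have hf0 : ∀ x, x ∉ Ω → f x = 0 := fun x hx => Set.indicator_of_notMem hx _
  have hweak : ∀ (a : E3) (φ : E3 → ℝ), ContDiff ℝ ∞ φ → HasCompactSupport φ →
      ∫ x, f x * fderiv ℝ φ x a = -∫ x, inner ℝ (h x) a * φ x := by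
    intro a φ hφ hφc
    have h1 := H'.setIntegral_truncation_add_eq_zero hΩ hae hγ hvγ' hφ hφc a
    have h2 : ∫ x, f x * fderiv ℝ φ x a =
        ∫ x in Ω, expNegInvGlue (u x - s) * inner ℝ (grad φ x) a := by
      rw [← integral_indicator hΩm]
      refine integral_congr_ae (.of_forall fun x => ?_)
      by_cases hx : x ∈ Ω <;> simp [hfdef, hx, inner_grad]
    have h3 : ∫ x, inner ℝ (h x) a * φ x =
        ∫ x in Ω, glueDeriv (u x - s) * inner ℝ (g x) (φ x • a) := by
      rw [← integral_indicator hΩm]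
      refine integral_congr_ae (.of_forall fun x => ?_)
      by_cases hx : x ∈ Ω
      · simp only [hhdef, Set.indicator_of_mem hx, real_inner_smul_left, real_inner_smul_right]
        ring
      · simp [hhdef, hx]
    rw [h2, h3]
    linarith
  obtain ⟨C, δ₀, hC, hδ₀, hstrip⟩ := exists_eLpNorm_strip_le hΩ hf hh hf0 hweak
  obtain ⟨C₁, hC₁, hcut⟩ := exists_cutoff
  -- The cutoff gradient vanishes at distance beyond `4δ`, hence outside the strip of width `5δ`;
  -- the factor `1/6` keeps `5δ` below `δ₀`.
  set δ : ℕ → ℝ := fun k => δ₀ / 6 * (1 / ((k : ℝ) + 1)) with hδdef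
  have hδpos : ∀ k, 0 < δ k := fun k => by positivity
  have hδlt : ∀ k, 5 * δ k < δ₀ := fun k => by
    have h1 : 1 / ((k : ℝ) + 1) ≤ 1 := by
      rw [div_le_one (by positivity)]
      linarith [Nat.cast_nonneg (α := ℝ) k]
    have h2 : δ k ≤ δ₀ / 6 * 1 := mul_le_mul_of_nonneg_left h1 (by positivity)
    linarith
  have hδanti : Antitone fun k => 5 * δ k := fun i j hij => by
    have := one_div_le_one_div_of_le (by positivity : (0 : ℝ) < (i : ℝ) + 1)
      (by exact_mod_cast Nat.succ_le_succ hij : (i : ℝ) + 1 ≤ (j : ℝ) + 1)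
    simp only [hδdef]
    gcongr
  have hδlim : Tendsto (fun k => 5 * δ k) atTop (𝓝 0) := by
    have := (tendsto_one_div_add_atTop_nhds_zero_nat (𝕜 := ℝ)).const_mul (δ₀ / 6) |>.const_mul 5
    simpa [hδdef] using this
  choose η hη hη01 hηd hη1 hηd0 using fun k =>
    hcut Ω hΩ.isOpen hΩ.isBounded (δ k) (hδpos k)
  -- For each `n` the function `ψ(vₙ - s) ηₖ` is a genuine test function, so harmonicity applies
  -- before the limit in `n`.
  have hηeq : ∀ k, (∫ x in Ω, glueDeriv (u x - s) * inner ℝ (g x) (η k x • g x)) +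
      ∫ x in Ω, expNegInvGlue (u x - s) * inner ℝ (grad (η k) x) (g x) = 0 := by
    intro k
    refine tendsto_nhds_unique (H'.tendsto_setIntegral_truncation hΩ.isBounded hae s (hη k).1
      (hη k).2.1 hg) (tendsto_const_nhds.congr fun n => ?_)
    exact (hharm _ ⟨(contDiff_truncation (H'.smooth n) s).mul (hη k).1, (hη k).2.1.mul_left,
      tsupport_mul_subset_right.trans (hη k).2.2⟩).symm
  set T : ℕ → ENNReal := fun k =>
    eLpNorm g 2 (volume.restrict (Ω ∩ {x | Metric.infDist x Ωᶜ < 5 * δ k})) with hTdef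
  have hT : Tendsto T atTop (𝓝 0) :=
    tendsto_eLpNorm_strip hΩ.isOpen hΩ.isBounded hg hδanti hδlim
  -- The cutoff gradient `C₁/δ` meets the strip bound `5Cδ`; the powers of `δ` cancel and the norm
  -- of `g` on the strip is left.
  have hB : ∀ k, ‖∫ x in Ω, expNegInvGlue (u x - s) * inner ℝ (grad (η k) x) (g x)‖ ≤
      5 * C₁ * C.toReal * (T k).toReal := by
    intro k
    set S : Set E3 := Ω ∩ {x | Metric.infDist x Ωᶜ < 5 * δ k}
    have hSm : MeasurableSet S := hΩm.inter
      (isOpen_lt (Metric.continuous_infDist_pt _) continuous_const).measurableSet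
    have hgS : MemLp g 2 (volume.restrict S) :=
      hg.mono_measure (Measure.restrict_mono Set.inter_subset_left le_rfl)
    have hfS : MemLp f 2 (volume.restrict S) := hf.restrict S
    have h1 : ∫ x in Ω, expNegInvGlue (u x - s) * inner ℝ (grad (η k) x) (g x) =
        ∫ x in S, expNegInvGlue (u x - s) * inner ℝ (grad (η k) x) (g x) := by
      refine setIntegral_eq_of_subset_of_forall_sdiff_eq_zero hΩm Set.inter_subset_left ?_
      rintro x ⟨hx, hxS⟩
      have : 4 * δ k < Metric.infDist x Ωᶜ := by
        have h5 : 5 * δ k ≤ Metric.infDist x Ωᶜ := not_lt.1 fun hlt => hxS ⟨hx, hlt⟩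
        linarith [hδpos k]
      rw [inner_grad, hηd0 k x this]
      simp
    have hprod : Integrable (fun x => f x * ‖g x‖) (volume.restrict S) :=
      hfS.integrable_mul hgS.norm
    have hcs := abs_integral_mul_le_eLpNorm hfS hgS.norm
    rw [eLpNorm_norm] at hcs
    have hfs : (eLpNorm f 2 (volume.restrict S)).toReal ≤ C.toReal * (5 * δ k) := by
      have := ENNReal.toReal_mono (ENNReal.mul_ne_top hC ENNReal.ofReal_ne_top)
        (hstrip (5 * δ k) (by have := hδpos k; positivity) (hδlt k))
      rwa [ENNReal.toReal_mul, ENNReal.toReal_ofReal (by have := hδpos k; positivity)] at this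
    rw [h1]
    calc _ ≤ ∫ x in S, C₁ / δ k * (f x * ‖g x‖) := by
          refine norm_integral_le_of_norm_le (hprod.const_mul _) ?_
          filter_upwards [ae_restrict_mem hSm] with x hx
          rw [hfdef, Set.indicator_of_mem hx.1, norm_mul, inner_grad,
            Real.norm_of_nonneg (expNegInvGlue.nonneg _)]
          have := ((fderiv ℝ (η k) x).le_opNorm (g x)).trans
            (mul_le_mul_of_nonneg_right (hηd k x) (norm_nonneg _))
          calc _ ≤ expNegInvGlue (u x - s) * (C₁ / δ k * ‖g x‖) :=
                mul_le_mul_of_nonneg_left this (expNegInvGlue.nonneg _)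
            _ = _ := by ring
      _ = C₁ / δ k * ∫ x in S, f x * ‖g x‖ := integral_const_mul _ _
      _ ≤ C₁ / δ k * (C.toReal * (5 * δ k) * (T k).toReal) := by
          have := hδpos k
          gcongr
          exact (le_abs_self _).trans (hcs.trans (by gcongr))
      _ = _ := by
          have := (hδpos k).ne'
          field_simp
  have hBlim : Tendsto (fun k => ∫ x in Ω, expNegInvGlue (u x - s) *
      inner ℝ (grad (η k) x) (g x)) atTop (𝓝 0) := by
    refine squeeze_zero_norm hB ?_
    have := ((ENNReal.tendsto_toReal ENNReal.zero_ne_top).comp hT).const_mul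
      (5 * C₁ * C.toReal)
    simpa [Function.comp_def] using this
  have hAlim : Tendsto (fun k => ∫ x in Ω, glueDeriv (u x - s) * inner ℝ (g x) (η k x • g x))
      atTop (𝓝 0) := by
    have := hBlim.neg
    rw [neg_zero] at this
    exact this.congr fun k => by linarith [hηeq k]
  have hgg := integrable_inner_of_memLp hg hg
  have hint : Integrable (fun x => glueDeriv (u x - s) * inner ℝ (g x) (g x))
      (volume.restrict Ω) := hgg.bdd_mul hψm' (.of_forall fun x => norm_glueDeriv_le _)
  have hAlim' : Tendsto (fun k => ∫ x in Ω, glueDeriv (u x - s) * inner ℝ (g x) (η k x • g x))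
      atTop (𝓝 (∫ x in Ω, glueDeriv (u x - s) * inner ℝ (g x) (g x))) := by
    refine tendsto_integral_of_dominated_convergence
      (fun x => ‖glueDeriv (u x - s) * inner ℝ (g x) (g x)‖) (fun k => ?_) hint.norm
      (fun k => .of_forall fun x => ?_) ?_
    · exact hψm'.mul (hg.aestronglyMeasurable.inner
        ((hη k).1.continuous.aestronglyMeasurable.smul hg.aestronglyMeasurable))
    · rw [real_inner_smul_right, mul_left_comm, norm_mul,
        Real.norm_of_nonneg (hη01 k x).1]
      exact mul_le_of_le_one_left (norm_nonneg _) (hη01 k x).2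
    · filter_upwards [ae_restrict_mem hΩm] with x hx
      have hpos : 0 < Metric.infDist x Ωᶜ :=
        (hΩ.isOpen.isClosed_compl.notMem_iff_infDist_pos
          (nonempty_compl_of_isBounded hΩ.isBounded)).1 (fun h => h hx)
      refine tendsto_const_nhds.congr' ?_
      filter_upwards [hδlim.eventually (gt_mem_nhds hpos)] with k hk
      rw [hη1 k x (by linarith [hδpos k]), one_smul]
  have hzero := tendsto_nhds_unique hAlim' hAlim
  rw [integral_eq_zero_iff_of_nonneg
    (fun x => mul_nonneg (glueDeriv_nonneg _) real_inner_self_nonneg) hint] at hzero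
  have hh0 : h =ᵐ[volume] 0 := by
    have h1 := (ae_restrict_iff' hΩm).1 hzero
    filter_upwards [h1] with x hx
    by_cases hxΩ : x ∈ Ω
    · rw [hhdef, Set.indicator_of_mem hxΩ]
      rcases mul_eq_zero.1 (hx hxΩ) with h2 | h2
      · simp [h2]
      · simp [inner_self_eq_zero.1 h2]
    · simp [hhdef, hxΩ]
  obtain ⟨R, hR⟩ := hΩ.isBounded.subset_ball 0
  -- This translation moves `Ω` off itself. A vanishing weak gradient makes `f` invariant under it,
  -- so `f` is zero.
  set a : E3 := EuclideanSpace.single 0 (2 * |R|) with hadef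
  have hexit : ∀ x ∈ Ω, x + a ∉ Ω := by
    intro x hx hxa
    have h1 := mem_ball_zero_iff.1 (hR hx)
    have h2 := mem_ball_zero_iff.1 (hR hxa)
    have h3 : ‖a‖ ≤ ‖x + a‖ + ‖x‖ := by
      simpa using norm_sub_le (x + a) x
    have h4 : ‖a‖ = 2 * |R| := by simp [hadef]
    linarith [le_abs_self R]
  have htr := eLpNorm_translate_sub_le (a := a) hf (hh.inner_const a) (hweak a)
  have h0 : eLpNorm (fun x => inner ℝ (h x) a) 2 = 0 := by
    rw [eLpNorm_congr_ae (g := fun _ => (0 : ℝ))]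
    · simp
    · filter_upwards [hh0] with x hx
      simp [hx]
  have hsm : AEStronglyMeasurable (fun x => f (x + a) - f x) volume :=
    ((hf.comp_measurePreserving (measurePreserving_add_right volume a)).sub
      hf).aestronglyMeasurable
  rw [h0, nonpos_iff_eq_zero, eLpNorm_eq_zero_iff hsm (by norm_num)] at htr
  rw [ae_restrict_iff' hΩm]
  filter_upwards [htr] with x hx hxΩ
  have h1 : f x = 0 := by
    have : f (x + a) - f x = 0 := hx
    rw [hf0 _ (hexit x hxΩ)] at this
    linarith
  rw [hfdef, Set.indicator_of_mem hxΩ, expNegInvGlue.zero_iff_nonpos] at h1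
  linarith

/-! ### Symmetric Jacobian and weak harmonicity of the components -/

lemma partialDeriv_eq (i : Fin 3) (f : E3 → ℝ) (x : E3) :
    partialDeriv i f x = fderiv ℝ f x (EuclideanSpace.single i 1) := rfl

lemma grad_apply (f : E3 → ℝ) (x : E3) (i : Fin 3) : grad f x i = partialDeriv i f x := by
  fin_cases i <;> rfl

lemma contDiff_partialDeriv {φ : E3 → ℝ} (hφ : ContDiff ℝ ∞ φ) (i : Fin 3) :
    ContDiff ℝ ∞ (partialDeriv i φ) :=
  (hφ.fderiv_right (m := ∞) (by simp)).clm_apply contDiff_const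

lemma IsTestFunction.partialDeriv {Ω : Set E3} {φ : E3 → ℝ} (hφ : IsTestFunction Ω φ) (i : Fin 3) :
    IsTestFunction Ω (partialDeriv i φ) := by
  refine ⟨contDiff_partialDeriv hφ.1 i, hφ.2.1.fderiv_apply (𝕜 := ℝ) _, ?_⟩
  exact (tsupport_fderiv_apply_subset ℝ _).trans hφ.2.2

lemma partialDeriv_comm {φ : E3 → ℝ} (hφ : ContDiff ℝ ∞ φ) (i j : Fin 3) (x : E3) :
    partialDeriv i (partialDeriv j φ) x = partialDeriv j (partialDeriv i φ) x := by
  have hd : DifferentiableAt ℝ (fderiv ℝ φ) x :=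
    (hφ.fderiv_right (m := ∞) (by simp)).differentiable (by simp) x
  have h : ∀ a b : E3, fderiv ℝ (fun y => fderiv ℝ φ y a) x b = fderiv ℝ (fderiv ℝ φ) x b a := by
    intro a b
    rw [fderiv_clm_apply hd (differentiableAt_const _)]
    simp
  have hsymm := (hφ.contDiffAt (x := x)).isSymmSndFDerivAt (by simp; exact WithTop.coe_le_coe.2 (le_top : (2 : ℕ∞) ≤ ⊤))
  calc _ = _ := h _ _
    _ = _ := hsymm.eq _ _
    _ = _ := (h _ _).symm

lemma fderiv_mul_apply {f g : E3 → ℝ} {x : E3} (hf : DifferentiableAt ℝ f x)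
    (hg : DifferentiableAt ℝ g x) (a : E3) :
    fderiv ℝ (fun y => f y * g y) x a = f x * fderiv ℝ g x a + fderiv ℝ f x a * g x := by
  rw [fderiv_fun_mul hf hg]
  simp [mul_comm]

lemma integrable_mul_of_continuous {Ω : Set E3} {u φ : E3 → ℝ}
    (hb : Bornology.IsBounded Ω) (hu : MemLp u 2 (volume.restrict Ω)) (hφ : Continuous φ) :
    Integrable (fun x => u x * φ x) (volume.restrict Ω) :=
  hu.integrable_mul (memLp_restrict_of_continuous hb hφ)

/-- Smooth functions are in `H¹` of a bounded open set. -/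
lemma isH1With_of_contDiff {Ω : Set E3} (hb : Bornology.IsBounded Ω) {χ : E3 → ℝ}
    (hχ : ContDiff ℝ ∞ χ) : IsH1With Ω χ (grad χ) := by
  have hgc := continuous_grad (hχ.of_le (by simp))
  refine ⟨memLp_restrict_of_continuous hb hχ.continuous, memLp_restrict_of_continuous hb hgc,
    fun φ hφ i => ?_⟩
  have h := setIntegral_fderiv_apply_eq_zero (Ω := Ω) (f := fun x => χ x * φ x)
    ((hχ.mul hφ.1).of_le (by simp)) hφ.2.1.mul_left (tsupport_mul_subset_right.trans hφ.2.2)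
    (EuclideanSpace.single i 1)
  simp only [fun x => fderiv_mul_apply (hχ.differentiable (by simp) x)
    (hφ.1.differentiable (by simp) x) (EuclideanSpace.single i 1), ← partialDeriv_eq] at h
  rw [integral_add] at h
  · simp only [grad_apply]
    linarith
  · exact integrable_mul_of_continuous hb
      (memLp_restrict_of_continuous hb hχ.continuous) (contDiff_partialDeriv hφ.1 i).continuous
  · exact integrable_mul_of_continuous hb
      (memLp_restrict_of_continuous hb (contDiff_partialDeriv hχ i).continuous) hφ.1.continuous

/-- Weak curl-freeness, componentwise. -/
lemma IsHarmonicNeumannField.integral_mul_partialDeriv_comm {Ω : Set E3} {Γ : E3 → E3}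
    (hb : Bornology.IsBounded Ω) (hΓ : IsHarmonicNeumannField Ω Γ) {φ : E3 → ℝ}
    (hφ : IsTestFunction Ω φ) (i j : Fin 3) :
    ∫ x in Ω, Γ x i * partialDeriv j φ x = ∫ x in Ω, Γ x j * partialDeriv i φ x := by
  have hmem : ∀ k, MemLp (fun x => Γ x k) 2 (volume.restrict Ω) := fun k =>
    (hΓ.memH1 k).choose_spec.memLp
  have hint : ∀ k l, Integrable (fun x => Γ x k * partialDeriv l φ x) (volume.restrict Ω) :=
    fun k l => integrable_mul_of_continuous hb (hmem k)
      (contDiff_partialDeriv hφ.1 l).continuous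
  -- The curl of `φ eₖ` isolates the antisymmetric relation between the two other components.
  have htest : ∀ k : Fin 3, IsTestFunction Ω (fun x => φ x • EuclideanSpace.single k (1 : ℝ)) :=
    fun k => ⟨hφ.1.smul contDiff_const, hφ.2.1.smul_right,
      (tsupport_smul_subset_left _ _).trans hφ.2.2⟩
  have h0 : ∀ x, inner ℝ (Γ x) (curl (fun x => φ x • EuclideanSpace.single (0 : Fin 3) (1 : ℝ)) x)
      = Γ x 1 * partialDeriv 2 φ x - Γ x 2 * partialDeriv 1 φ x := fun x => by
    simp [curl, partialDeriv, PiLp.inner_apply, Fin.sum_univ_three]; ring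
  have h1 : ∀ x, inner ℝ (Γ x) (curl (fun x => φ x • EuclideanSpace.single (1 : Fin 3) (1 : ℝ)) x)
      = Γ x 2 * partialDeriv 0 φ x - Γ x 0 * partialDeriv 2 φ x := fun x => by
    simp [curl, partialDeriv, PiLp.inner_apply, Fin.sum_univ_three]; ring
  have h2 : ∀ x, inner ℝ (Γ x) (curl (fun x => φ x • EuclideanSpace.single (2 : Fin 3) (1 : ℝ)) x)
      = Γ x 0 * partialDeriv 1 φ x - Γ x 1 * partialDeriv 0 φ x := fun x => by
    simp [curl, partialDeriv, PiLp.inner_apply, Fin.sum_univ_three]; ring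
  have e0 := hΓ.curlFree _ (htest 0)
  have e1 := hΓ.curlFree _ (htest 1)
  have e2 := hΓ.curlFree _ (htest 2)
  simp only [h0, h1, h2] at e0 e1 e2
  rw [integral_sub (hint _ _) (hint _ _), sub_eq_zero] at e0 e1 e2
  fin_cases i <;> fin_cases j
  · rfl
  · exact e2
  · exact e1.symm
  · exact e2.symm
  · rfl
  · exact e0
  · exact e1
  · exact e0.symm
  · rfl

/-- The weak Jacobian of a harmonic Neumann field is symmetric. -/
lemma IsHarmonicNeumannField.ae_grad_symm {Ω : Set E3} {Γ : E3 → E3} (hΩ : IsOpen Ω)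
    (hb : Bornology.IsBounded Ω) (hΓ : IsHarmonicNeumannField Ω Γ) {g : Fin 3 → E3 → E3}
    (hg : ∀ i, IsH1With Ω (fun x => Γ x i) (g i)) (i j : Fin 3) :
    ∀ᵐ x ∂volume.restrict Ω, g i x j = g j x i := by
  have hfin : IsFiniteMeasure (volume.restrict Ω) := ⟨by simpa using hb.measure_lt_top⟩
  have hmem : ∀ k l, MemLp (fun x => g k x l) 2 (volume.restrict Ω) := fun k l =>
    (hg k).memLp_grad.eval_piLp l
  have hint : Integrable (fun x => g i x j - g j x i) (volume.restrict Ω) :=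
    ((hmem i j).sub (hmem j i)).integrable (by norm_num)
  rw [ae_restrict_iff' hΩ.measurableSet]
  have h := hΩ.ae_eq_zero_of_integral_contDiff_smul_eq_zero (μ := volume)
    (f := fun x => g i x j - g j x i) (IntegrableOn.locallyIntegrableOn hint) (by
      intro φ hφ hφc hφΩ
      have ht : IsTestFunction Ω φ := ⟨hφ, hφc, hφΩ⟩
      rw [← setIntegral_eq_integral_of_forall_compl_eq_zero (s := Ω)
        (fun x hx => by rw [image_eq_zero_of_notMem_tsupport fun h => hx (hφΩ h), zero_smul])]
      have h1 := (hg i).weak_grad φ ht j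
      have h2 := (hg j).weak_grad φ ht i
      have h3 := hΓ.integral_mul_partialDeriv_comm hb ht i j
      have h4 := integral_sub
        (integrable_mul_of_continuous hb (hmem i j) hφ.continuous)
        (integrable_mul_of_continuous hb (hmem j i) hφ.continuous)
      simp only [smul_eq_mul, mul_comm (φ _), sub_mul]
      linarith)
  filter_upwards [h] with x hx hxΩ
  exact sub_eq_zero.1 (hx hxΩ)

/-- The components of a harmonic Neumann field are weakly harmonic. -/
lemma IsHarmonicNeumannField.integral_fderiv_grad_eq_zero {Ω : Set E3} {Γ : E3 → E3}
    (hΩ : IsOpen Ω) (hb : Bornology.IsBounded Ω) (hΓ : IsHarmonicNeumannField Ω Γ)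
    {g : Fin 3 → E3 → E3} (hg : ∀ i, IsH1With Ω (fun x => Γ x i) (g i)) (i : Fin 3)
    {φ : E3 → ℝ} (hφ : IsTestFunction Ω φ) : ∫ x in Ω, fderiv ℝ φ x (g i x) = 0 := by
  have hpc : ∀ j k, Continuous (partialDeriv j (partialDeriv k φ)) :=
    fun j k => (contDiff_partialDeriv (contDiff_partialDeriv hφ.1 k) j).continuous
  -- Testing with `∇∂ᵢφ` gives `∑ⱼ ∫ Γⱼ ∂ᵢ∂ⱼφ = 0`; moving `∂ᵢ` onto `Γⱼ` and using `∂ᵢΓⱼ = ∂ⱼΓᵢ`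
  -- yields harmonicity of `Γᵢ`.
  have h1 := hΓ.divFree_tangent _ _ (isH1With_of_contDiff hb (hφ.partialDeriv i).1)
  have h2 : ∀ x, inner ℝ (Γ x) (grad (partialDeriv i φ) x) =
      ∑ j, Γ x j * partialDeriv i (partialDeriv j φ) x := by
    intro x
    simp only [PiLp.inner_apply, grad_apply, fun j => partialDeriv_comm hφ.1 i j x]
    simp [mul_comm]
  have h3 : ∀ x, fderiv ℝ φ x (g i x) = ∑ j, g i x j * partialDeriv j φ x := by
    intro x
    rw [← inner_grad]
    simp [PiLp.inner_apply, grad_apply]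
  simp only [h2] at h1
  simp only [h3]
  rw [integral_finsetSum _ fun j _ => integrable_mul_of_continuous hb
    (hg j).memLp (hpc i j)] at h1
  rw [integral_finsetSum _ fun j _ => integrable_mul_of_continuous hb
    ((hg i).memLp_grad.eval_piLp j) (contDiff_partialDeriv hφ.1 j).continuous]
  rw [← neg_eq_zero, ← h1, ← Finset.sum_neg_distrib]
  refine Finset.sum_congr rfl fun j _ => ?_
  rw [(hg j).weak_grad _ (hφ.partialDeriv j) i, neg_inj]
  refine integral_congr_ae ?_
  filter_upwards [hΓ.ae_grad_symm hΩ hb hg i j] with x hx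
  rw [hx]

/-! ### Pohozaev-type identities -/

lemma tendsto_eLpNorm_sum_smul {α F : Type*} [MeasurableSpace α] {μ : Measure α}
    [NormedAddCommGroup F] [NormedSpace ℝ F] {w : Fin 3 → ℕ → α → F} (b : Fin 3 → ℝ)
    (hw : ∀ i n, AEStronglyMeasurable (w i n) μ)
    (h : ∀ i, Tendsto (fun n => eLpNorm (w i n) 2 μ) atTop (𝓝 0)) :
    Tendsto (fun n => eLpNorm (∑ i, b i • w i n) 2 μ) atTop (𝓝 0) := by
  have h1 : Tendsto (fun n => ∑ i, ‖b i‖ₑ * eLpNorm (w i n) 2 μ) atTop (𝓝 0) := by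
    have := tendsto_finsetSum (Finset.univ : Finset (Fin 3)) fun i _ =>
      ENNReal.Tendsto.const_mul (a := ‖b i‖ₑ) (h i) (Or.inr (by simp))
    simpa using this
  refine tendsto_of_tendsto_of_tendsto_of_le_of_le tendsto_const_nhds h1 (fun _ => zero_le)
    fun n => ?_
  refine (eLpNorm_sum_le (fun i _ => (hw i n).const_smul (b i)) (by norm_num)).trans ?_
  exact Finset.sum_le_sum fun i _ => (eLpNorm_const_smul _ _ _ _).le

lemma tendsto_integral_mul {α : Type*} [MeasurableSpace α] {μ : Measure α} {a b : ℕ → α → ℝ}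
    {a₀ b₀ : α → ℝ} (ha : ∀ n, MemLp (a n) 2 μ) (hb : ∀ n, MemLp (b n) 2 μ) (ha₀ : MemLp a₀ 2 μ)
    (hb₀ : MemLp b₀ 2 μ) (hla : Tendsto (fun n => eLpNorm (fun x => a n x - a₀ x) 2 μ) atTop (𝓝 0))
    (hlb : Tendsto (fun n => eLpNorm (fun x => b n x - b₀ x) 2 μ) atTop (𝓝 0)) :
    Tendsto (fun n => ∫ x, a n x * b n x ∂μ) atTop (𝓝 (∫ x, a₀ x * b₀ x ∂μ)) := by
  have key : ∀ {f g : α → ℝ} (hf : MemLp f 2 μ) (hg : MemLp g 2 μ),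
      inner ℝ (hf.toLp f) (hg.toLp g) = ∫ x, f x * g x ∂μ := by
    intro f g hf hg
    rw [L2.inner_def]
    refine integral_congr_ae ?_
    filter_upwards [hf.coeFn_toLp, hg.coeFn_toLp] with x hx hx'
    rw [hx, hx']
    simp [mul_comm]
  have h1 := (Lp.tendsto_Lp_iff_tendsto_eLpNorm'' a ha a₀ ha₀).2 hla
  have h2 := (Lp.tendsto_Lp_iff_tendsto_eLpNorm'' b hb b₀ hb₀).2 hlb
  have h3 := h1.inner (𝕜 := ℝ) h2
  simpa only [key] using h3

/-- Hölder's inequality applied to `v² - γ² = (v - γ)((v - γ) + 2γ)`. -/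
lemma tendsto_lintegral_sq_sub_sq {α : Type*} [MeasurableSpace α] {μ : Measure α}
    {v : ℕ → α → ℝ} {γ : α → ℝ} (hv : ∀ n, AEStronglyMeasurable (v n) μ) (hγ : MemLp γ 2 μ)
    (h : Tendsto (fun n => eLpNorm (fun x => v n x - γ x) 2 μ) atTop (𝓝 0)) :
    Tendsto (fun n => ∫⁻ x, ‖v n x ^ 2 - γ x ^ 2‖ₑ ∂μ) atTop (𝓝 0) := by
  set E := eLpNorm (fun x => 2 * γ x) 2 μ with hE
  have h2γ : MemLp (fun x => 2 * γ x) 2 μ := hγ.const_mul 2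
  have h1 : Tendsto (fun n => eLpNorm (fun x => v n x - γ x) 2 μ *
      (eLpNorm (fun x => v n x - γ x) 2 μ + E)) atTop (𝓝 0) := by
    have := ENNReal.Tendsto.mul h (Or.inr (by simpa using h2γ.eLpNorm_ne_top))
      (h.add (tendsto_const_nhds (x := E))) (Or.inr (by simp))
    simpa using this
  refine tendsto_of_tendsto_of_tendsto_of_le_of_le tendsto_const_nhds h1 (fun _ => zero_le)
    fun n => ?_
  have hd : AEStronglyMeasurable (fun x => v n x - γ x) μ := (hv n).sub hγ.aestronglyMeasurable
  have hs : AEStronglyMeasurable (fun x => (v n x - γ x) + 2 * γ x) μ :=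
    hd.add h2γ.aestronglyMeasurable
  have h2 := eLpNorm_smul_le_mul_eLpNorm (p := 2) (q := 2) (r := 1) hs hd
  rw [eLpNorm_one_eq_lintegral_enorm] at h2
  have h3 : ∀ x, v n x ^ 2 - γ x ^ 2 =
      ((fun x => v n x - γ x) • fun x => (v n x - γ x) + 2 * γ x) x := fun x => by
    simp only [Pi.smul_apply', smul_eq_mul]; ring
  simp only [h3]
  refine h2.trans ?_
  gcongr
  exact eLpNorm_add_le hd h2γ.aestronglyMeasurable (by norm_num)

lemma IsTestFunction.coord_mul {Ω : Set E3} {φ : E3 → ℝ} (hφ : IsTestFunction Ω φ) (i : Fin 3) :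
    IsTestFunction Ω (fun x => x i * φ x) :=
  ⟨(contDiff_piLp_apply (p := 2)).mul hφ.1, hφ.2.1.mul_left,
    tsupport_mul_subset_right.trans hφ.2.2⟩

lemma fderiv_coord (i : Fin 3) (x a : E3) : fderiv ℝ (fun y : E3 => y i) x a = a i := by
  have h : HasFDerivAt (fun y : E3 => y i) (EuclideanSpace.proj i : E3 →L[ℝ] ℝ) x :=
    (EuclideanSpace.proj i : E3 →L[ℝ] ℝ).hasFDerivAt
  rw [h.fderiv]
  rfl

lemma exists_abs_coord_le {Ω : Set E3} (hb : Bornology.IsBounded Ω) :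
    ∃ R : ℝ, 0 ≤ R ∧ ∀ x ∈ closure Ω, ∀ i : Fin 3, |x i| ≤ R := by
  obtain ⟨R, hR⟩ := hb.closure.subset_closedBall 0
  refine ⟨|R|, abs_nonneg R, fun x hx i => ?_⟩
  have h1 := mem_closedBall_zero_iff.1 (hR hx)
  have h2 := PiLp.norm_apply_le x i
  exact h2.trans (h1.trans (le_abs_self R))

/-- Multiplication by coordinates preserves `L²` of a bounded set. -/
lemma memLp_coord_mul {Ω : Set E3} (hΩ : IsOpen Ω) (hb : Bornology.IsBounded Ω)
    {u : E3 → ℝ} (hu : MemLp u 2 (volume.restrict Ω)) (i : Fin 3) :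
    MemLp (fun x => x i * u x) 2 (volume.restrict Ω) := by
  obtain ⟨R, hR, hRb⟩ := exists_abs_coord_le hb
  have hc : Continuous fun x : E3 => x i := by fun_prop
  refine hu.of_le_mul (c := R) (hc.aestronglyMeasurable.mul hu.aestronglyMeasurable) ?_
  filter_upwards [ae_restrict_mem hΩ.measurableSet] with x hx
  rw [norm_mul]
  gcongr
  exact hRb x (subset_closure hx) i

/-- The weak gradient of `u` is tested with `xᵢ φ`. This makes `xᵢ Γᵢ` an admissible potential
against `Γ`. -/
lemma IsH1With.coord_mul {Ω : Set E3} (hΩ : IsOpen Ω) (hb : Bornology.IsBounded Ω) {u : E3 → ℝ}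
    {g : E3 → E3} (hu : IsH1With Ω u g) (i : Fin 3) :
    IsH1With Ω (fun x => x i * u x) (fun x => x i • g x + u x • EuclideanSpace.single i (1 : ℝ)) := by
  obtain ⟨R, hR, hRb⟩ := exists_abs_coord_le hb
  have hc : Continuous fun x : E3 => x i := by fun_prop
  have h1 : MemLp (fun x => x i • g x) 2 (volume.restrict Ω) := by
    refine hu.memLp_grad.of_le_mul (c := R)
      (hc.aestronglyMeasurable.smul hu.memLp_grad.aestronglyMeasurable) ?_
    filter_upwards [ae_restrict_mem hΩ.measurableSet] with x hx
    rw [norm_smul]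
    gcongr
    exact hRb x (subset_closure hx) i
  have h2 : MemLp (fun x => u x • EuclideanSpace.single i (1 : ℝ)) 2 (volume.restrict Ω) := by
    refine hu.memLp.of_le (hu.memLp.aestronglyMeasurable.smul_const _) (.of_forall fun x => ?_)
    simp [norm_smul]
  refine ⟨memLp_coord_mul hΩ hb hu.memLp i, h1.add h2, fun φ hφ j => ?_⟩
  have h := hu.weak_grad _ (hφ.coord_mul i) j
  have hd : ∀ x, partialDeriv j (fun x => x i * φ x) x =
      x i * partialDeriv j φ x + EuclideanSpace.single j (1 : ℝ) i * φ x := fun x => by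
    rw [partialDeriv_eq, fderiv_mul_apply (by fun_prop) (hφ.1.differentiable (by simp) x),
      fderiv_coord, partialDeriv_eq]
  have hint1 := integrable_mul_of_continuous hb hu.memLp
    (hc.fun_mul (contDiff_partialDeriv hφ.1 j).continuous)
  have hint2 := integrable_mul_of_continuous hb hu.memLp
    (hφ.1.continuous.const_mul (EuclideanSpace.single j (1 : ℝ) i))
  have hint3 := integrable_mul_of_continuous hb
    (hu.memLp_grad.eval_piLp j) (hc.fun_mul hφ.1.continuous)
  simp only [hd, mul_add] at h
  rw [integral_add hint1 hint2] at h
  have hL : ∫ x in Ω, x i * u x * partialDeriv j φ x =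
      ∫ x in Ω, u x * (x i * partialDeriv j φ x) :=
    integral_congr_ae (.of_forall fun x => by ring)
  have hR' : ∫ x in Ω, (x i • g x + u x • EuclideanSpace.single i (1 : ℝ)) j * φ x =
      (∫ x in Ω, g x j * (x i * φ x)) +
        ∫ x in Ω, u x * (EuclideanSpace.single j (1 : ℝ) i * φ x) := by
    rw [← integral_add hint3 hint2]
    refine integral_congr_ae (.of_forall fun x => ?_)
    simp only [PiLp.add_apply, PiLp.smul_apply, smul_eq_mul, PiLp.single_apply,
      eq_comm (a := i)]
    ring
  rw [hL, hR']
  linarith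

lemma hasFDerivAt_sum_sq_sub {v : Fin 3 → E3 → ℝ} (hv : ∀ j, Differentiable ℝ (v j)) (c : ℝ)
    (x : E3) : HasFDerivAt (fun y => ∑ j, v j y ^ 2 - c)
      (∑ j, (2 * v j x) • fderiv ℝ (v j) x) x := by
  refine (HasFDerivAt.fun_sum fun j _ => ?_).sub_const c
  simpa using! (hv j x).hasFDerivAt.pow 2

/-- If `|u|² = c` on the boundary, then `∫_Ω ∂ᵢ(xᵢ (|u|² - c)) = 0`. -/
lemma sum_integral_sq_add_eq {Ω : Set E3} (hΩ : IsBoundedSmoothDomain Ω) {u γ : Fin 3 → E3 → ℝ}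
    {g : Fin 3 → E3 → E3} {v : Fin 3 → ℕ → E3 → ℝ} (H : ∀ j, H1Approx Ω (u j) (g j) (v j))
    (hγ : ∀ j, MemLp (γ j) 2 (surfaceMeasure Ω))
    (hvγ : ∀ j, Tendsto (fun n => eLpNorm (fun x => v j n x - γ j x) 2 (surfaceMeasure Ω))
      atTop (𝓝 0)) {c : ℝ} (hc : ∀ᵐ x ∂surfaceMeasure Ω, ∑ j, γ j x ^ 2 = c) (i : Fin 3) :
    ∑ j, ((∫ x in Ω, u j x * u j x) + 2 * ∫ x in Ω, (x i * u j x) * g j x i) =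
      c * volume.real Ω := by
  have hb := hΩ.isBounded
  have hΩm := hΩ.isOpen.measurableSet
  have hfin : IsFiniteMeasure (volume.restrict Ω) := ⟨by simpa using hb.measure_lt_top⟩
  obtain ⟨R, hR, hRb⟩ := exists_abs_coord_le hb
  have hxc : ContDiff ℝ ∞ (fun x : E3 => x i) := contDiff_piLp_apply (p := 2)
  have hvL : ∀ j n, MemLp (v j n) 2 (volume.restrict Ω) := fun j n =>
    memLp_restrict_of_continuous hb ((H j).smooth n).continuous
  have hxvL : ∀ j n, MemLp (fun x => x i * v j n x) 2 (volume.restrict Ω) := fun j n =>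
    memLp_coord_mul hΩ.isOpen hb (hvL j n) i
  have hdL : ∀ j n, MemLp (partialDeriv i (v j n)) 2 (volume.restrict Ω) := fun j n =>
    memLp_restrict_of_continuous hb (contDiff_partialDeriv ((H j).smooth n) i).continuous
  have hdlim : ∀ j, Tendsto (fun n => eLpNorm (fun x => partialDeriv i (v j n) x - g j x i) 2
      (volume.restrict Ω)) atTop (𝓝 0) := fun j => by
    refine tendsto_of_tendsto_of_tendsto_of_le_of_le tendsto_const_nhds (H j).tendsto_grad
      (fun _ => zero_le) fun n => eLpNorm_mono fun x => ?_
    simpa [grad_apply] using PiLp.norm_apply_le (grad (v j n) x - g j x) i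
  have hxvlim : ∀ j, Tendsto (fun n => eLpNorm (fun x => x i * v j n x - x i * u j x) 2
      (volume.restrict Ω)) atTop (𝓝 0) := fun j => by
    have h1 := ENNReal.Tendsto.const_mul (a := ENNReal.ofReal R) (H j).tendsto (Or.inr (by simp))
    rw [mul_zero] at h1
    refine tendsto_of_tendsto_of_tendsto_of_le_of_le tendsto_const_nhds h1 (fun _ => zero_le)
      fun n => eLpNorm_le_mul_eLpNorm_of_ae_le_mul ?_ 2
    filter_upwards [ae_restrict_mem hΩm] with x hx
    rw [← mul_sub, norm_mul]
    gcongr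
    exact hRb x (subset_closure hx) i
  -- Smooth substitutes for `xᵢ (|u|² - c)`: their boundary values tend to zero in `L¹(∂Ω)`, so the
  -- integrals of `∂ᵢFₙ` do too.
  set F : ℕ → E3 → ℝ := fun n x => x i * (∑ j, v j n x ^ 2 - c)
  have hF : ∀ n, ContDiff ℝ 1 (F n) := fun n =>
    (hxc.mul ((ContDiff.sum fun j _ => ((H j).smooth n).pow 2).sub contDiff_const)).of_le (by simp)
  have hFd : ∀ n x, fderiv ℝ (F n) x (EuclideanSpace.single i 1) =
      ∑ j, (v j n x * v j n x + 2 * ((x i * v j n x) * partialDeriv i (v j n) x)) - c := by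
    intro n x
    have h1 := hasFDerivAt_sum_sq_sub (v := fun j => v j n)
      (fun j => ((H j).smooth n).differentiable (by simp)) c x
    have h2 := fderiv_mul_apply (hxc.differentiable (by simp) x) h1.differentiableAt
      (EuclideanSpace.single i 1)
    rw [h1.fderiv, fderiv_coord] at h2
    refine h2.trans ?_
    simp only [Fin.sum_univ_three, partialDeriv_eq]
    simp
    ring
  have hlim : Tendsto (fun n => ∫ x in Ω, fderiv ℝ (F n) x (EuclideanSpace.single i 1)) atTop
      (𝓝 (∑ j, ((∫ x in Ω, u j x * u j x) + 2 * ∫ x in Ω, (x i * u j x) * g j x i) -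
        c * volume.real Ω)) := by
    have hsum := tendsto_finsetSum (Finset.univ : Finset (Fin 3)) fun j _ =>
      (tendsto_integral_mul (hvL j) (hvL j) (H j).memLp (H j).memLp (H j).tendsto
        (H j).tendsto).add ((tendsto_integral_mul (hxvL j) (hdL j)
        (memLp_coord_mul hΩ.isOpen hb (H j).memLp i) ((H j).memLp_grad.eval_piLp i) (hxvlim j)
        (hdlim j)).const_mul 2)
    refine (hsum.sub_const (c * volume.real Ω)).congr fun n => ?_
    have hi1 : ∀ j, Integrable (fun x => v j n x * v j n x) (volume.restrict Ω) := fun j =>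
      (hvL j n).integrable_mul (hvL j n)
    have hi2 : ∀ j, Integrable (fun x => 2 * ((x i * v j n x) * partialDeriv i (v j n) x))
        (volume.restrict Ω) := fun j => ((hxvL j n).integrable_mul (hdL j n)).const_mul 2
    have hi3 : ∀ j, Integrable (fun x => v j n x * v j n x +
        2 * ((x i * v j n x) * partialDeriv i (v j n) x)) (volume.restrict Ω) := fun j =>
      (hi1 j).add (hi2 j)
    simp only [hFd]
    rw [integral_sub (integrable_finsetSum _ fun j _ => hi3 j) (integrable_const c),
      integral_finsetSum _ fun j _ => hi3 j, setIntegral_const, smul_eq_mul,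
      mul_comm c]
    congr 1
    refine Finset.sum_congr rfl fun j _ => ?_
    rw [integral_add (hi1 j) (hi2 j), integral_const_mul]
  obtain ⟨C, hC⟩ := exists_enorm_setIntegral_fderiv_le hΩ (EuclideanSpace.single i 1)
  have hbd : Tendsto (fun n => C * (ENNReal.ofReal R *
      ∑ j, ∫⁻ x, ‖v j n x ^ 2 - γ j x ^ 2‖ₑ ∂surfaceMeasure Ω)) atTop (𝓝 0) := by
    have h1 := tendsto_finsetSum (Finset.univ : Finset (Fin 3)) fun j _ =>
      tendsto_lintegral_sq_sub_sq (fun n => ((H j).smooth n).continuous.aestronglyMeasurable)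
        (hγ j) (hvγ j)
    have := ENNReal.Tendsto.const_mul (a := (C : ENNReal))
      (ENNReal.Tendsto.const_mul (a := ENNReal.ofReal R) h1 (Or.inr (by simp))) (Or.inr (by simp))
    simpa using this
  have hzero : Tendsto (fun n => ∫ x in Ω, fderiv ℝ (F n) x (EuclideanSpace.single i 1)) atTop
      (𝓝 0) := by
    rw [tendsto_zero_iff_enorm_tendsto_zero]
    refine tendsto_of_tendsto_of_tendsto_of_le_of_le tendsto_const_nhds hbd (fun _ => zero_le)
      fun n => (hC _ (hF n)).trans ?_
    have hmeas : ∀ j, AEMeasurable (fun x => ‖v j n x ^ 2 - γ j x ^ 2‖ₑ) (surfaceMeasure Ω) :=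
      fun j => ((((H j).smooth n).continuous.aestronglyMeasurable.pow 2).sub
        ((hγ j).aestronglyMeasurable.pow 2)).enorm
    rw [← lintegral_finsetSum' _ fun j _ => hmeas j,
      ← lintegral_const_mul' (ENNReal.ofReal R) _ (by simp)]
    refine mul_le_mul_right (lintegral_mono_ae ?_) _
    filter_upwards [hc, ae_restrict_mem isClosed_frontier.measurableSet] with x hx hxf
    have hFx : F n x = x i * ∑ j, (v j n x ^ 2 - γ j x ^ 2) := by
      rw [Finset.sum_sub_distrib, hx]
    rw [hFx, enorm_mul]
    refine mul_le_mul' ?_ (enorm_sum_le _ _)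
    rw [← ofReal_norm]
    exact ENNReal.ofReal_le_ofReal (hRb x (frontier_subset_closure hxf) i)
  exact sub_eq_zero.1 (tendsto_nhds_unique hlim hzero)

/-- Testing against the gradient of `xᵢ Γᵢ`. -/
lemma IsHarmonicNeumannField.sum_integral_coord_mul_eq_zero {Ω : Set E3} {Γ : E3 → E3}
    (hΩ : IsOpen Ω) (hb : Bornology.IsBounded Ω) (hΓ : IsHarmonicNeumannField Ω Γ)
    {g : Fin 3 → E3 → E3} (hg : ∀ i, IsH1With Ω (fun x => Γ x i) (g i)) (i : Fin 3) :
    (∑ j, ∫ x in Ω, (x i * Γ x j) * g j x i) + ∫ x in Ω, Γ x i * Γ x i = 0 := by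
  have h := hΓ.divFree_tangent _ _ ((hg i).coord_mul hΩ hb i)
  have h1 : ∀ x, inner ℝ (Γ x) (x i • g i x + Γ x i • EuclideanSpace.single i (1 : ℝ)) =
      ∑ j, (x i * Γ x j) * g i x j + Γ x i * Γ x i := by
    intro x
    rw [inner_add_right, real_inner_smul_right, real_inner_smul_right,
      EuclideanSpace.inner_single_right, PiLp.inner_apply, Finset.mul_sum]
    simp only [RCLike.inner_apply, conj_trivial, one_mul]
    congr 1
    exact Finset.sum_congr rfl fun j _ => by ring
  simp only [h1] at h
  have hi : ∀ j, Integrable (fun x => (x i * Γ x j) * g i x j) (volume.restrict Ω) := fun j =>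
    (memLp_coord_mul hΩ hb (hg j).memLp i).integrable_mul ((hg i).memLp_grad.eval_piLp j)
  have hi' : Integrable (fun x => Γ x i * Γ x i) (volume.restrict Ω) :=
    (hg i).memLp.integrable_mul (hg i).memLp
  rw [integral_add (integrable_finsetSum _ fun j _ => hi j) hi', integral_finsetSum _ fun j _ => hi j] at h
  rw [← h]
  congr 1
  refine Finset.sum_congr rfl fun j _ => integral_congr_ae ?_
  filter_upwards [hΓ.ae_grad_symm hΩ hb hg i j] with x hx
  rw [hx]

/-- The approximations of the components give approximations of every directional component. -/
lemma H1Approx.sum {Ω : Set E3} {u : Fin 3 → E3 → ℝ} {g : Fin 3 → E3 → E3}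
    {v : Fin 3 → ℕ → E3 → ℝ} (H : ∀ j, H1Approx Ω (u j) (g j) (v j)) (b : Fin 3 → ℝ) :
    H1Approx Ω (fun x => ∑ j, b j * u j x) (fun x => ∑ j, b j • g j x)
      (fun n x => ∑ j, b j * v j n x) := by
  refine ⟨memLp_finsetSum _ fun j _ => (H j).memLp.const_mul (b j),
    memLp_finsetSum _ fun j _ => (H j).memLp_grad.const_smul (b j),
    fun n => ContDiff.sum fun j _ => contDiff_const.mul ((H j).smooth n), ?_, ?_⟩
  · refine (tendsto_eLpNorm_sum_smul b (fun j n =>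
      ((H j).smooth n).continuous.aestronglyMeasurable.sub (H j).memLp.aestronglyMeasurable)
      fun j => (H j).tendsto).congr fun n => ?_
    congr 1
    funext x
    simp [Finset.sum_apply, mul_sub, Finset.sum_sub_distrib]
  · refine (tendsto_eLpNorm_sum_smul b (fun j n =>
      (continuous_grad (((H j).smooth n).of_le (by simp))).aestronglyMeasurable.sub
        (H j).memLp_grad.aestronglyMeasurable) fun j => (H j).tendsto_grad).congr fun n => ?_
    congr 1
    funext x
    have hgr : grad (fun x => ∑ j, b j * v j n x) x = ∑ j, b j • grad (v j n) x := by
      refine ext_inner_right ℝ fun a => ?_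
      rw [inner_grad, sum_inner, fderiv_fun_sum fun j _ =>
        (((H j).smooth n).differentiable (by simp) x).const_mul (b j)]
      simp only [real_inner_smul_left, inner_grad,
        fun j => fderiv_const_mul (((H j).smooth n).differentiable (by simp) x) (b j)]
      simp
    rw [hgr]
    simp [Finset.sum_apply, smul_sub, Finset.sum_sub_distrib]

end HarmonicNeumann

/-! ### Conclusion -/

open HarmonicNeumann in
theorem propositionA1 (Ω : Set E3) (hΩ : HarmonicNeumann.IsBoundedSmoothDomain Ω)
    (Γ : E3 → E3) (hΓ : HarmonicNeumann.IsHarmonicNeumannField Ω Γ)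
    (G : E3 → E3) (hG : HarmonicNeumann.IsVectorTrace Ω Γ G)
    (c : ℝ) (hc : 0 ≤ c)
    (hconst : ∀ᵐ x ∂(HarmonicNeumann.surfaceMeasure Ω), ‖G x‖ ^ 2 = c) :
    Γ =ᵐ[volume.restrict Ω] 0 := by
  have hb := hΩ.isBounded
  have hfin : IsFiniteMeasure (volume.restrict Ω) := ⟨by simpa using hb.measure_lt_top⟩
  have hγ : ∀ j, MemLp (fun x => G x j) 2 (surfaceMeasure Ω) := fun j => (hG j).1
  choose g v hg hv hvu hvg hvγ using fun j => (hG j).2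
  have H : ∀ j, H1Approx Ω (fun x => Γ x j) (g j) (v j) := fun j =>
    ⟨(hg j).memLp, (hg j).memLp_grad, hv j, hvu j, hvg j⟩
  have hinner : ∀ x b : E3, inner ℝ x b = ∑ j, b j * x j := fun x b => by
    simp [PiLp.inner_apply]
  have hnorm : ∀ x : E3, ‖x‖ ^ 2 = ∑ j, x j ^ 2 := fun x => by
    simp [EuclideanSpace.norm_sq_eq]
  have hle : ∀ b : E3, ∀ᵐ x ∂volume.restrict Ω, inner ℝ (Γ x) b ≤ √c * ‖b‖ := by
    intro b
    simp only [hinner]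
    refine (H1Approx.sum H b).ae_le_of_trace_le hΩ (γ := fun x => ∑ j, b j * G x j) ?_ ?_ ?_
    · intro φ hφ
      have hi : ∀ j, Integrable (fun x => fderiv ℝ φ x (b j • g j x)) (volume.restrict Ω) := by
        intro j
        simp only [← inner_grad]
        exact integrable_inner_of_memLp
          (memLp_restrict_of_continuous hb (continuous_grad (hφ.1.of_le (by simp))))
          ((hg j).memLp_grad.const_smul (b j))
      simp only [map_sum]
      rw [integral_finsetSum _ fun j _ => hi j]
      refine Finset.sum_eq_zero fun j _ => ?_
      simp only [map_smul, smul_eq_mul]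
      rw [integral_const_mul, hΓ.integral_fderiv_grad_eq_zero hΩ.isOpen hb hg j hφ, mul_zero]
    · filter_upwards [hconst] with x hx
      rw [← hinner, ← hx, Real.sqrt_sq (norm_nonneg _)]
      exact real_inner_le_norm _ _
    · refine (tendsto_eLpNorm_sum_smul b (fun j n =>
        (hv j n).continuous.aestronglyMeasurable.sub (hγ j).aestronglyMeasurable)
        hvγ).congr fun n => ?_
      congr 1
      funext x
      simp [Finset.sum_apply, mul_sub, Finset.sum_sub_distrib]
  have hbound : ∀ᵐ x ∂volume.restrict Ω, ‖Γ x‖ ^ 2 ≤ c := by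
    -- The exceptional null set depends on `b`; a countable dense set of directions gives a common
    -- one, after which `b = Γ x` may be taken.
    have h := ae_all_iff.2 fun n => hle (TopologicalSpace.denseSeq E3 n)
    filter_upwards [h] with x hx
    have hall : ∀ b : E3, inner ℝ (Γ x) b ≤ √c * ‖b‖ := fun b =>
      (TopologicalSpace.denseRange_denseSeq E3).induction_on
        (p := fun b => inner ℝ (Γ x) b ≤ √c * ‖b‖) b
        (isClosed_le (by fun_prop) (by fun_prop)) hx
    have h1 := hall (Γ x)
    rw [real_inner_self_eq_norm_sq, sq] at h1
    have h2 : ‖Γ x‖ ≤ √c := by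
      rcases (norm_nonneg (Γ x)).eq_or_lt with h0 | h0
      · rw [← h0]; positivity
      · exact le_of_mul_le_mul_right h1 h0
    calc ‖Γ x‖ ^ 2 ≤ √c ^ 2 := by gcongr
      _ = c := Real.sq_sqrt hc
  have hsq : ∫ x in Ω, ‖Γ x‖ ^ 2 = ∑ j, ∫ x in Ω, Γ x j * Γ x j := by
    simp only [hnorm, sq]
    exact integral_finsetSum _ fun j _ => (hg j).memLp.integrable_mul (hg j).memLp
  have hP : ∫ x in Ω, ‖Γ x‖ ^ 2 = 3 * (c * volume.real Ω) := by
    have h1 := sum_integral_sq_add_eq hΩ H hγ hvγ (c := c)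
      (by filter_upwards [hconst] with x hx; rw [← hnorm, hx])
    have h2 := hΓ.sum_integral_coord_mul_eq_zero hΩ.isOpen hb hg
    have h10 := h1 0
    have h11 := h1 1
    have h12 := h1 2
    have h20 := h2 0
    have h21 := h2 1
    have h22 := h2 2
    rw [hsq]
    simp only [Fin.sum_univ_three] at *
    -- With `X = ∑ᵢⱼ ∫ xᵢ Γⱼ ∂ᵢΓⱼ`, the identities read `3 ∫ |Γ|² + 2X = 3 c |Ω|` and `X = -∫ |Γ|²`.
    linarith
  have hi : Integrable (fun x => ‖Γ x‖ ^ 2) (volume.restrict Ω) := by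
    simp only [hnorm, sq]
    exact integrable_finsetSum _ fun j _ => (hg j).memLp.integrable_mul (hg j).memLp
  have hle2 : ∫ x in Ω, ‖Γ x‖ ^ 2 ≤ c * volume.real Ω := by
    refine (integral_mono_ae hi (integrable_const c) hbound).trans_eq ?_
    rw [setIntegral_const, smul_eq_mul, mul_comm]
  have hvol : 0 < volume.real Ω :=
    ENNReal.toReal_pos (hΩ.isOpen.measure_pos _ hΩ.isConnected.nonempty).ne'
      hb.measure_lt_top.ne
  -- Here `3 c |Ω| ≤ c |Ω|` with `|Ω| > 0` and `c ≥ 0`.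
  have hc0 : c = 0 := by nlinarith
  filter_upwards [hbound] with x hx
  rw [hc0] at hx
  have : ‖Γ x‖ = 0 := by nlinarith [norm_nonneg (Γ x)]
  exact norm_eq_zero.1 this
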